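/- Let $\Pi$ be a measure on $(0,\infty)$ with $\int_0^\infty \min(1,x)\,\Pi(dx)<\infty$ and $\Pi(0,\infty)=\infty$, and let $$\Phi(\lambda)=\int_0^\infty (1-e^{-\lambda x})\,\Pi(dx),\qquad \lambda>0 .$$ Let $H=\{H_t\}_{t\ge 0}$ be a subordinator with symbol $\Phi$ on a probability space, that is, a process with $H_0=0$ a.s., with independent and stationary increments, with a.s. nondecreasing right-continuous paths, and with $\mathbf E[e^{-\lambda H_t}]=e^{-t\Phi(\lambda)}$ for $t\ge 0$, $\lambda>0$. Let $L_t=\inf\{s\ge 0: H_s>t\}$ be its inverse. Let $\kappa$ be a real function on $(0,\infty)$ with $$\int_0^\infty e^{-\lambda t}\kappa(t)\,dt=\frac{\Phi(\lambda)}{\lambda}\qquad\text{for all }\lambda>0,$$ the integrals being absolutely convergent. For a continuous function $\psi:[0,\infty)\to\mathbb R$ let $\psi'$ be its distributional derivative on $[0,\infty)$, that is, the derivative of the distribution on $\mathbb R$ given by the function which equals $\psi(s)-\psi(0)$ for $s\ge 0$ and $0$ for $s<0$, and put $$D_t^\Phi\psi=\psi'*\kappa ,$$ the convolution of distributions supported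 in $[0,\infty)$ ($\kappa$ being extended by $0$). Explicitly, $D_t^\Phi\psi=f$ on $(0,\infty)$, for a continuous function $f$, means that $$-\int_0^\infty(\psi(s)-\psi(0))\,\frac{d}{ds}\Big(\int_0^\infty\kappa(r)\,\eta(s+r)\,dr\Big)ds=\int_0^\infty f(t)\,\eta(t)\,dt\qquad\text{for all }\eta\in C_c^\infty((0,\infty)).$$ Let $\theta>0$ and $\varphi(t)=\mathbf E[e^{-\theta L_t}]$, $t\ge 0$. Then $\varphi$ is the unique continuous function on $[0,\infty)$ with $$D_t^\Phi\varphi(t)=-\theta\,\varphi(t),\quad t>0,\qquad \varphi(0)=1 .$$ Moreover, $\varphi$ is nonincreasing, so that $\varphi'$ is a measure $\varphi'(ds)\le 0$ on $(0,\infty)$, and the convolution is an absolutely convergent integral: for almost every $t>0$, $$\int_{(0,t)}\kappa(t-s)\,\varphi'(ds)=-\theta\,\varphi(t).$$ -/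

import Mathlib

open MeasureTheory ProbabilityTheory Set Filter
open scoped NNReal ENNReal

/-- The Lévy measure of a driftless, unkilled subordinator with infinite activity: a measure
`Π` carried by `(0, ∞)` with `∫ min(1, x) Π(dx) < ∞` and `Π(0, ∞) = ∞`. The last condition says
that the Lévy tail `Π(t, ∞)` is singular at `t = 0`; equivalently, the subordinator is strictly
increasing. -/
structure IsInfiniteLevyMeasure (Lvy : Measure ℝ) : Prop where
  null_nonpos : Lvy (Iic 0) = 0
  finite_min : ∫⁻ x, ENNReal.ofReal (min 1 x) ∂Lvy < ∞
  infinite : Lvy (Ioi 0) = ∞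

/-- The Bernstein function `Φ(lam) = ∫_0^∞ (1 - exp(-lam x)) Π(dx)`. -/
noncomputable def bernsteinSymbol (Lvy : Measure ℝ) (lam : ℝ) : ℝ :=
  ∫ x in Ioi 0, (1 - Real.exp (-lam * x)) ∂Lvy

/-- `H` is a subordinator started at `0` with symbol `Φ`: a process with independent and
stationary increments, almost surely nondecreasing right-continuous paths, `H 0 = 0`, and
`E[exp(-lam H_t)] = exp(-t Φ(lam))`. -/
structure IsSubordinator {Ω : Type*} [MeasurableSpace Ω] (P : Measure Ω)
    (H : ℝ≥0 → Ω → ℝ) (Φ : ℝ → ℝ) : Prop where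
  measurable : ∀ t, Measurable (H t)
  start : ∀ᵐ ω ∂P, H 0 ω = 0
  indep : HasIndepIncrements H P
  stationary : ∀ s t, IdentDistrib (fun ω => H (s + t) ω - H s ω) (H t) P P
  mono : ∀ᵐ ω ∂P, Monotone (fun t => H t ω)
  rightCont : ∀ᵐ ω ∂P, ∀ t, ContinuousWithinAt (fun s => H s ω) (Ici t) t
  laplace : ∀ (t : ℝ≥0) (lam : ℝ), 0 < lam →
    ∫ ω, Real.exp (-lam * H t ω) ∂P = Real.exp (-(t : ℝ) * Φ lam)

/-- The inverse `L_t = inf {s ≥ 0 : H_s > t}` of `H`. (The set is empty only on a null event when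
`H` is a subordinator that is not identically zero, since then `H_s → ∞` almost surely.) -/
noncomputable def inverseProcess {Ω : Type*} (H : ℝ≥0 → Ω → ℝ) (t : ℝ) (ω : Ω) : ℝ≥0 :=
  sInf {s : ℝ≥0 | t < H s ω}

/-- The function `t ↦ E[exp(-θ L_t)]`. -/
noncomputable def inverseLaplace {Ω : Type*} [MeasurableSpace Ω] (P : Measure Ω)
    (H : ℝ≥0 → Ω → ℝ) (θ t : ℝ) : ℝ :=
  ∫ ω, Real.exp (-θ * (inverseProcess H t ω : ℝ)) ∂P

/-- `κ` is a kernel on `(0, ∞)` whose Laplace transform is `Φ(lam) / lam` for all `lam > 0`. -/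
def IsKernelOf (Φ κ : ℝ → ℝ) : Prop :=
  ∀ lam : ℝ, 0 < lam →
    IntegrableOn (fun t => Real.exp (-lam * t) * κ t) (Ioi 0) ∧
    ∫ t in Ioi 0, Real.exp (-lam * t) * κ t = Φ lam / lam

/-- The pairing `⟨ψ', ζ⟩` of a test function `ζ` with the distributional derivative `ψ'` of a
function `ψ` on `[0, ∞)`, that is, of the function which is `ψ(s) - ψ(0)` for `s ≥ 0` and `0`
for `s < 0`. -/
noncomputable def derivPairing (ψ ζ : ℝ → ℝ) : ℝ :=
  -∫ s in Ioi 0, (ψ s - ψ 0) * deriv ζ s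

/-- The function `s ↦ ∫_0^∞ κ(r) η(s + r) dr`, by which one pairs a convolution with `κ`
with the test function `η`: `⟨T * κ, η⟩ = ⟨T, reflConv κ η⟩`. -/
noncomputable def reflConv (κ η : ℝ → ℝ) (s : ℝ) : ℝ :=
  ∫ r in Ioi 0, κ r * η (s + r)

/-- The Caputo-type derivative `ψ' * κ` of `ψ` is the function `f` on `(0, ∞)`, where `ψ'` is the
distributional derivative of `ψ` and the convolution is that of distributions supported in
`[0, ∞)`: for all `η ∈ C_c^∞((0, ∞))`, `⟨ψ' * κ, η⟩ = ∫ f η`. -/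
def HasCaputoDeriv (κ ψ f : ℝ → ℝ) : Prop :=
  ∀ η : ℝ → ℝ, ContDiff ℝ (⊤ : ℕ∞) η → HasCompactSupport η → tsupport η ⊆ Ioi 0 →
    derivPairing ψ (reflConv κ η) = ∫ t in Ioi 0, f t * η t

/-- `ψ` is a solution on `[0, ∞)` of `ψ' * κ = -θ ψ` on `(0, ∞)`, `ψ(0) = 1`. -/
structure IsRelaxationSolution (κ : ℝ → ℝ) (θ : ℝ) (ψ : ℝ → ℝ) : Prop where
  continuousOn : ContinuousOn ψ (Ici 0)
  initial : ψ 0 = 1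
  equation : HasCaputoDeriv κ ψ (fun t => -θ * ψ t)

/-- `ψ` is nonincreasing on `[0, ∞)` and its derivative is the measure `-μ` on `(0, ∞)`. -/
def IsNegDerivMeasure (ψ : ℝ → ℝ) (μ : Measure ℝ) : Prop :=
  AntitoneOn ψ (Ici 0) ∧ ∀ t, 0 ≤ t → μ (Ioc 0 t) = ENNReal.ofReal (ψ 0 - ψ t)

/-! Laplace transforms identify $\varphi$. Take independent exponential times $\tau,\sigma$ of rates
$\lambda,\theta$, independent of $H$. The probability of $L_\tau<\sigma$ is $\mathbf
E\varphi(\tau)=\lambda\hat\varphi(\lambda)$ when $\sigma$ is integrated out. Since $L_t<s$ and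
$t<H_s$ agree up to a null event, it is also $\mathbf
E[1-e^{-\sigma\Phi(\lambda)}]=\Phi/(\theta+\Phi)$. Hence $\hat\varphi=\Phi/(\lambda(\theta+\Phi))$.
Infinite activity makes $H$ strictly increasing, so $L$ and then $\varphi$ are continuous.

Existence is a comparison of transforms. Tested against $\eta'$, the weak equation says that
$(\psi-\psi(0))*\kappa$ and $-\theta\,\psi*1$ agree; for $\varphi$ this is
$(1-\varphi)*\kappa=\theta\,\varphi*1$ (`causalConv_one_sub_kernel`). With $\mu=-d\varphi$ one has
$\hat\mu=\theta/(\theta+\Phi)$, so $\hat\mu\hat\kappa=\theta\hat\varphi$, which is the integral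
form.

Uniqueness cannot use the transform of a competitor $\psi$, whose growth is unrestricted. For
$u=\psi-\varphi$ the equation gives $(u*(\kappa+\theta))'=0$ weakly, so $u*(\kappa+\theta)$ is
constant (du Bois-Reymond), and the constant is $0$ because the convolution is small near $0$.
Convolving with $1-\varphi$, where $(\kappa+\theta)*(1-\varphi)=\theta t$, leaves $u*t=0$; two
differentiations give $u=0$. -/

/-! ### Uniqueness of Laplace transforms -/

/-- If all Laplace integrals of `g` vanish then `g` integrates to zero against
`exp (-t) * p (exp (-t))` for every polynomial `p`. -/
theorem integral_polynomial_exp_eq_zero {g : ℝ → ℝ}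
    (hint : ∀ lam : ℝ, 0 < lam → IntegrableOn (fun t => Real.exp (-lam * t) * g t) (Ioi 0))
    (hzero : ∀ lam : ℝ, 0 < lam → ∫ t in Ioi 0, Real.exp (-lam * t) * g t = 0)
    (p : Polynomial ℝ) :
    ∫ t in Ioi 0, p.eval (Real.exp (-t)) * (Real.exp (-t) * g t) = 0 := by
  have key : ∀ (t : ℝ), p.eval (Real.exp (-t)) * (Real.exp (-t) * g t) =
      ∑ i ∈ Finset.range (p.natDegree + 1),
        p.coeff i * (Real.exp (-((i : ℝ) + 1) * t) * g t) := by
    intro t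
    rw [Polynomial.eval_eq_sum_range, Finset.sum_mul]
    refine Finset.sum_congr rfl fun i _ => ?_
    have : Real.exp (-((i : ℝ) + 1) * t) = Real.exp (-t) ^ i * Real.exp (-t) := by
      rw [← Real.exp_nat_mul, ← Real.exp_add]; congr 1; ring
    rw [this]; ring
  simp_rw [key]
  rw [integral_finsetSum]
  · refine Finset.sum_eq_zero fun i _ => ?_
    rw [integral_const_mul, hzero _ (by positivity), mul_zero]
  · intro i _
    exact (hint _ (by positivity)).const_mul _

/-- A function on `(0, ∞)` whose Laplace transform vanishes is almost everywhere zero. -/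
theorem ae_eq_zero_of_laplace_eq_zero {g : ℝ → ℝ}
    (hint : ∀ lam : ℝ, 0 < lam → IntegrableOn (fun t => Real.exp (-lam * t) * g t) (Ioi 0))
    (hzero : ∀ lam : ℝ, 0 < lam → ∫ t in Ioi 0, Real.exp (-lam * t) * g t = 0) :
    ∀ᵐ t ∂volume, t ∈ Ioi (0 : ℝ) → g t = 0 := by
  have h1 : IntegrableOn (fun t => Real.exp (-t) * g t) (Ioi 0) := by
    simpa using hint 1 one_pos
  have key : ∀ᵐ t ∂volume, t ∈ Ioi (0 : ℝ) → Real.exp (-t) * g t = 0 := by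
    refine isOpen_Ioi.ae_eq_zero_of_integral_contDiff_smul_eq_zero
      h1.locallyIntegrableOn fun η hη hηc hηs => ?_
    have hη0 : ∀ t, t ≤ 0 → η t = 0 := fun t ht =>
      image_eq_zero_of_notMem_tsupport fun h => absurd (hηs h) (not_lt.mpr ht)
    obtain ⟨b, hb⟩ : ∃ b, ∀ t, b < t → η t = 0 := by
      obtain ⟨b, hb⟩ := hηc.bddAbove
      exact ⟨b, fun t ht => image_eq_zero_of_notMem_tsupport
        fun h => absurd (hb h) (not_le.mpr ht)⟩
    have hF : ∫ t, η t • (Real.exp (-t) * g t) = ∫ t in Ioi 0, η t * (Real.exp (-t) * g t) := by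
      rw [← integral_indicator measurableSet_Ioi]
      refine integral_congr_ae (Eventually.of_forall fun t => ?_)
      by_cases ht : t ∈ Ioi (0 : ℝ)
      · simp [indicator_of_mem ht]
      · simp [indicator_of_notMem ht, hη0 t (not_lt.mp ht)]
    rw [hF]
    -- The substitution $y=e^{-t}$ turns the problem into Weierstrass approximation on $[0,1]$. Near
    -- $y=0$ the function vanishes because $\eta$ is zero for large $t$; at $y=0$ itself `Real.log 0
    -- = 0`, and $\eta(0)=0$.
    have hcont : ContinuousOn (fun y => η (-Real.log y)) (Icc 0 1) := by
      intro y hy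
      refine ContinuousAt.continuousWithinAt ?_
      rcases eq_or_lt_of_le hy.1 with rfl | hy0
      · have hev : (fun y => η (-Real.log y)) =ᶠ[nhds 0] fun _ => 0 := by
          have : Iio (Real.exp (-b)) ∩ Ioi (-Real.exp (-b)) ∈ nhds (0 : ℝ) := by
            refine inter_mem (Iio_mem_nhds (Real.exp_pos _)) (Ioi_mem_nhds ?_)
            linarith [Real.exp_pos (-b)]
          filter_upwards [this] with y hy
          rcases eq_or_ne y 0 with rfl | hne
          · simp [hη0 0 le_rfl]
          · refine hb _ ?_
            have hlt : |y| < Real.exp (-b) := abs_lt.mpr ⟨hy.2, hy.1⟩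
            have := Real.log_lt_log (abs_pos.mpr hne) hlt
            rw [Real.log_abs, Real.log_exp] at this
            linarith
        exact (continuousAt_const).congr hev.symm
      · exact hη.continuous.continuousAt.comp (Real.continuousAt_log hy0.ne').neg
    have hsmall : ∀ ε > 0, |∫ t in Ioi 0, η t * (Real.exp (-t) * g t)| ≤
        ε * ∫ t in Ioi 0, |Real.exp (-t) * g t| := by
      intro ε hε
      obtain ⟨p, hp⟩ := exists_polynomial_near_of_continuousOn 0 1 _ hcont ε hε
      have hp' : ∀ t ∈ Ioi (0 : ℝ), |η t - p.eval (Real.exp (-t))| ≤ ε := by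
        intro t ht
        have ht' : (0 : ℝ) < t := ht
        have := hp (Real.exp (-t)) ⟨(Real.exp_pos _).le, by
          rw [Real.exp_le_one_iff]; linarith⟩
        rw [Real.log_exp, neg_neg, abs_sub_comm] at this
        exact this.le
      have hI1 : IntegrableOn (fun t => p.eval (Real.exp (-t)) * (Real.exp (-t) * g t))
          (Ioi 0) := by
        obtain ⟨C, hC⟩ := (isCompact_Icc (a := (0 : ℝ)) (b := 1)).exists_bound_of_continuousOn
          p.continuous.continuousOn
        refine Integrable.bdd_mul (c := C) h1 (by fun_prop) ?_
        filter_upwards [ae_restrict_mem measurableSet_Ioi] with t ht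
        have ht' : (0 : ℝ) < t := ht
        exact hC _ ⟨(Real.exp_pos _).le, by rw [Real.exp_le_one_iff]; linarith⟩
      have hI2 : IntegrableOn (fun t => η t * (Real.exp (-t) * g t)) (Ioi 0) := by
        obtain ⟨C, hC⟩ := hηc.exists_bound_of_continuous hη.continuous
        exact Integrable.bdd_mul (c := C) h1 hη.continuous.aestronglyMeasurable
          (Eventually.of_forall hC)
      have : ∫ t in Ioi 0, η t * (Real.exp (-t) * g t) =
          ∫ t in Ioi 0, (η t - p.eval (Real.exp (-t))) * (Real.exp (-t) * g t) := by
        simp_rw [sub_mul]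
        rw [integral_sub hI2 hI1, integral_polynomial_exp_eq_zero hint hzero, sub_zero]
      rw [this, ← integral_const_mul, ← Real.norm_eq_abs]
      refine norm_integral_le_of_norm_le (h1.abs.const_mul ε) ?_
      filter_upwards [ae_restrict_mem measurableSet_Ioi] with t ht
      rw [norm_mul]
      exact mul_le_mul_of_nonneg_right (hp' t ht) (norm_nonneg _)
    have hnn : 0 ≤ ∫ t in Ioi 0, |Real.exp (-t) * g t| := integral_nonneg fun _ => abs_nonneg _
    by_contra hne
    have hpos := abs_pos.mpr hne
    set I := |∫ t in Ioi 0, η t * (Real.exp (-t) * g t)|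
    set J := ∫ t in Ioi 0, |Real.exp (-t) * g t|
    -- The $+1$ covers the case $J=0$.
    have := hsmall (I / (2 * (J + 1))) (by positivity)
    have h2 : I / (2 * (J + 1)) * J < I := by
      rw [div_mul_eq_mul_div, div_lt_iff₀ (by positivity)]
      nlinarith
    linarith
  filter_upwards [key] with t ht h0
  exact (mul_eq_zero.mp (ht h0)).resolve_left (Real.exp_pos _).ne'

/-- Two functions on `(0, ∞)` with the same Laplace transform are almost everywhere equal. -/
theorem ae_eq_of_laplace_eq {f g : ℝ → ℝ}
    (hf : ∀ lam : ℝ, 0 < lam → IntegrableOn (fun t => Real.exp (-lam * t) * f t) (Ioi 0))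
    (hg : ∀ lam : ℝ, 0 < lam → IntegrableOn (fun t => Real.exp (-lam * t) * g t) (Ioi 0))
    (h : ∀ lam : ℝ, 0 < lam → ∫ t in Ioi 0, Real.exp (-lam * t) * f t =
      ∫ t in Ioi 0, Real.exp (-lam * t) * g t) :
    ∀ᵐ t ∂volume, t ∈ Ioi (0 : ℝ) → f t = g t := by
  have := ae_eq_zero_of_laplace_eq_zero (g := fun t => f t - g t)
    (fun lam hl => by simp_rw [mul_sub]; exact (hf lam hl).sub (hg lam hl))
    (fun lam hl => by
      simp_rw [mul_sub]
      rw [integral_sub (hf lam hl) (hg lam hl), h lam hl, sub_self])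
  filter_upwards [this] with t ht h0
  exact sub_eq_zero.mp (ht h0)

/-! ### The symbol $\Phi$ -/

theorem one_sub_exp_nonneg {lam x : ℝ} (hl : 0 ≤ lam) (hx : 0 ≤ x) :
    0 ≤ 1 - Real.exp (-lam * x) := by
  rw [sub_nonneg, Real.exp_le_one_iff]
  nlinarith

theorem one_sub_exp_le_max_mul_min {lam x : ℝ} (hx : 0 ≤ x) :
    1 - Real.exp (-lam * x) ≤ max 1 lam * min 1 x := by
  rcases le_total 1 x with h | h
  · rw [min_eq_left h, mul_one]
    linarith [le_max_left 1 lam, Real.exp_pos (-lam * x)]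
  · rw [min_eq_right h]
    have h1 := Real.add_one_le_exp (-lam * x)
    have h2 := mul_le_mul_of_nonneg_right (le_max_right 1 lam) hx
    linarith

theorem IsInfiniteLevyMeasure.integrableOn_symbol {Lvy : Measure ℝ}
    (hLvy : IsInfiniteLevyMeasure Lvy) {lam : ℝ} (hl : 0 ≤ lam) :
    IntegrableOn (fun x => 1 - Real.exp (-lam * x)) (Ioi 0) Lvy := by
  have hmin : Integrable (fun x => min 1 x) (Lvy.restrict (Ioi 0)) := by
    refine ⟨by fun_prop, ?_⟩
    rw [hasFiniteIntegral_iff_ofReal]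
    · exact lt_of_le_of_lt (setLIntegral_le_lintegral _ _) hLvy.finite_min
    · filter_upwards [ae_restrict_mem measurableSet_Ioi] with x hx
      exact le_min zero_le_one (le_of_lt hx)
  refine (hmin.const_mul (max 1 lam)).mono' (by fun_prop) ?_
  filter_upwards [ae_restrict_mem measurableSet_Ioi] with x hx
  rw [Real.norm_of_nonneg (one_sub_exp_nonneg hl (le_of_lt hx))]
  exact one_sub_exp_le_max_mul_min (le_of_lt hx)

theorem IsInfiniteLevyMeasure.ofReal_symbol {Lvy : Measure ℝ}
    (hLvy : IsInfiniteLevyMeasure Lvy) {lam : ℝ} (hl : 0 ≤ lam) :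
    ENNReal.ofReal (bernsteinSymbol Lvy lam) =
      ∫⁻ x in Ioi 0, ENNReal.ofReal (1 - Real.exp (-lam * x)) ∂Lvy := by
  refine ofReal_integral_eq_lintegral_ofReal (hLvy.integrableOn_symbol hl) ?_
  filter_upwards [ae_restrict_mem measurableSet_Ioi] with x hx
  exact one_sub_exp_nonneg hl (le_of_lt hx)

theorem IsInfiniteLevyMeasure.symbol_pos {Lvy : Measure ℝ}
    (hLvy : IsInfiniteLevyMeasure Lvy) {lam : ℝ} (hl : 0 < lam) :
    0 < bernsteinSymbol Lvy lam := by
  rw [← ENNReal.ofReal_pos, hLvy.ofReal_symbol hl.le, pos_iff_ne_zero, ne_eq,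
    lintegral_eq_zero_iff (by fun_prop)]
  intro h
  have hz : ∀ᵐ x ∂Lvy.restrict (Ioi 0), False := by
    filter_upwards [h, ae_restrict_mem measurableSet_Ioi] with x hx hx0
    have hx0' : 0 < x := hx0
    have : Real.exp (-lam * x) < 1 := by rw [Real.exp_lt_one_iff]; nlinarith
    simp only [Pi.zero_apply, ENNReal.ofReal_eq_zero] at hx
    linarith
  have : Lvy.restrict (Ioi 0) univ = 0 := by
    rw [ae_iff] at hz
    simpa only [not_false_eq_true, ofPred_true] using hz
  rw [Measure.restrict_apply_univ, hLvy.infinite] at this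
  exact ENNReal.top_ne_zero this

/-- Monotone convergence: $1-e^{-nx}$ increases to $1$ on $(0,\infty)$, and $\Pi(0,\infty)=\infty$.
-/
theorem IsInfiniteLevyMeasure.tendsto_symbol_atTop {Lvy : Measure ℝ}
    (hLvy : IsInfiniteLevyMeasure Lvy) :
    Tendsto (fun n : ℕ => bernsteinSymbol Lvy n) atTop atTop := by
  have h1 : Tendsto (fun n : ℕ => ENNReal.ofReal (bernsteinSymbol Lvy n)) atTop (nhds ∞) := by
    have : ∫⁻ _ in Ioi (0 : ℝ), 1 ∂Lvy = ∞ := by simp [hLvy.infinite]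
    rw [← this]
    simp_rw [fun n : ℕ => hLvy.ofReal_symbol (lam := n) n.cast_nonneg]
    refine lintegral_tendsto_of_tendsto_of_monotone (fun n => by fun_prop) ?_ ?_
    · filter_upwards [ae_restrict_mem measurableSet_Ioi] with x hx
      intro m n hmn
      have hx0 : 0 < x := hx
      have : (m : ℝ) ≤ n := by exact_mod_cast hmn
      refine ENNReal.ofReal_le_ofReal (sub_le_sub_left (Real.exp_le_exp.mpr ?_) _)
      nlinarith
    · filter_upwards [ae_restrict_mem measurableSet_Ioi] with x hx
      have hx0 : 0 < x := hx
      rw [← ENNReal.ofReal_one]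
      refine ENNReal.tendsto_ofReal ?_
      have : Tendsto (fun n : ℕ => Real.exp (-(n : ℝ) * x)) atTop (nhds 0) := by
        refine Real.tendsto_exp_atBot.comp ?_
        simp_rw [neg_mul]
        exact tendsto_neg_atTop_atBot.comp (tendsto_natCast_atTop_atTop.atTop_mul_const hx0)
      simpa using this.const_sub 1
  rw [tendsto_atTop]
  intro b
  have := h1.eventually (lt_mem_nhds (ENNReal.ofReal_lt_top (r := b)))
  filter_upwards [this] with n hn
  by_contra hlt
  exact absurd (ENNReal.ofReal_le_ofReal (not_le.mp hlt).le) (not_le.mpr hn)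

/-! ### Strict increase and divergence of the subordinator -/

section StrictlyIncreasing

variable {Ω : Type*} [MeasurableSpace Ω] {P : Measure Ω} [IsProbabilityMeasure P]

/-- A version of the Markov inequality for the Laplace transform. -/
theorem real_measure_le_le_exp_mul_laplace {X : Ω → ℝ} (hX : Measurable X)
    (hX0 : ∀ᵐ ω ∂P, 0 ≤ X ω) {lam : ℝ} (hl : 0 ≤ lam) (x : ℝ) :
    P.real {ω | X ω ≤ x} ≤ Real.exp (lam * x) * ∫ ω, Real.exp (-lam * X ω) ∂P := by
  have hint : Integrable (fun ω => Real.exp (-lam * X ω)) P := by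
    refine Integrable.of_bound (by fun_prop) 1 ?_
    filter_upwards [hX0] with ω hω
    rw [Real.norm_of_nonneg (Real.exp_pos _).le, Real.exp_le_one_iff]
    nlinarith
  rw [← integral_indicator_one (measurableSet_le hX measurable_const), ← integral_const_mul]
  refine integral_mono_of_nonneg
    (Eventually.of_forall fun ω => indicator_nonneg (fun _ _ => zero_le_one) _)
    (hint.const_mul _) (Eventually.of_forall fun ω => ?_)
  by_cases h : X ω ≤ x
  · simp only [indicator, mem_ofPred_eq, h, if_true, Pi.one_apply]
    rw [← Real.exp_add]
    refine Real.one_le_exp ?_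
    nlinarith
  · simp only [indicator, mem_ofPred_eq, h, if_false]
    positivity

section Subordinator

variable {Lvy : Measure ℝ} {H : ℝ≥0 → Ω → ℝ}

omit [IsProbabilityMeasure P] in
theorem IsSubordinator.ae_nonneg {Φ : ℝ → ℝ} (hH : IsSubordinator P H Φ) (t : ℝ≥0) :
    ∀ᵐ ω ∂P, 0 ≤ H t ω := by
  filter_upwards [hH.start, hH.mono] with ω h0 hm
  rw [← h0]
  exact hm (zero_le (a := t))

/-- The exponential Markov bound gives $P(H_n\le m)\le e^{m}e^{-n\Phi(1)}\to0$ as $n\to\infty$. -/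
theorem IsSubordinator.ae_unbounded (hLvy : IsInfiniteLevyMeasure Lvy)
    (hH : IsSubordinator P H (bernsteinSymbol Lvy)) :
    ∀ᵐ ω ∂P, ∀ x : ℝ, ∃ t, x < H t ω := by
  have hnat : ∀ᵐ ω ∂P, ∀ m : ℕ, ∃ n : ℕ, (m : ℝ) < H n ω := by
    rw [ae_all_iff]
    intro m
    have hΦ := hLvy.symbol_pos one_pos
    have hlim : Tendsto (fun n : ℕ => Real.exp (1 * m) *
        Real.exp (-(n : ℝ) * bernsteinSymbol Lvy 1)) atTop (nhds 0) := by
      rw [← mul_zero (Real.exp (1 * m))]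
      refine Tendsto.const_mul _ (Real.tendsto_exp_atBot.comp ?_)
      simp_rw [neg_mul]
      exact tendsto_neg_atTop_atBot.comp (tendsto_natCast_atTop_atTop.atTop_mul_const hΦ)
    have hz : P.real {ω | ¬ ∃ n : ℕ, (m : ℝ) < H n ω} ≤ 0 := by
      refine ge_of_tendsto' hlim fun n => ?_
      have h1 := real_measure_le_le_exp_mul_laplace (hH.measurable n) (hH.ae_nonneg n)
        zero_le_one (m : ℝ)
      rw [hH.laplace n 1 one_pos] at h1
      refine le_trans (measureReal_mono fun ω hω => ?_) h1
      simp only [not_exists, not_lt, mem_ofPred_eq] at hω ⊢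
      exact hω n
    rw [ae_iff]
    exact (measureReal_eq_zero_iff).mp (le_antisymm hz measureReal_nonneg)
  filter_upwards [hnat] with ω hω x
  obtain ⟨m, hm⟩ := exists_nat_ge x
  obtain ⟨n, hn⟩ := hω m
  exact ⟨n, hm.trans_lt hn⟩

/-- Here infinite activity enters: $P(H_t\le 0)\le e^{-t\Phi(n)}$ for every $n\ge1$, and
$\Phi(n)\to\infty$. -/
theorem IsSubordinator.ae_pos (hLvy : IsInfiniteLevyMeasure Lvy)
    (hH : IsSubordinator P H (bernsteinSymbol Lvy)) {t : ℝ≥0} (ht : 0 < t) :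
    ∀ᵐ ω ∂P, 0 < H t ω := by
  have hz : P.real {ω | ¬ 0 < H t ω} ≤ 0 := by
    have hlim : Tendsto (fun n : ℕ => Real.exp (-(t : ℝ) * bernsteinSymbol Lvy n))
        atTop (nhds 0) := by
      refine Real.tendsto_exp_atBot.comp ?_
      simp_rw [neg_mul]
      exact tendsto_neg_atTop_atBot.comp
        (hLvy.tendsto_symbol_atTop.const_mul_atTop (by exact_mod_cast ht))
    refine ge_of_tendsto hlim ?_
    filter_upwards [eventually_gt_atTop 0] with n hn
    have hn' : (0 : ℝ) < n := by exact_mod_cast hn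
    have h1 := real_measure_le_le_exp_mul_laplace (hH.measurable t) (hH.ae_nonneg t)
      hn'.le 0
    rw [hH.laplace t n hn', mul_zero, Real.exp_zero, one_mul] at h1
    simpa only [not_lt] using h1
  rw [ae_iff]
  exact (measureReal_eq_zero_iff).mp (le_antisymm hz measureReal_nonneg)

theorem IsSubordinator.ae_lt (hLvy : IsInfiniteLevyMeasure Lvy)
    (hH : IsSubordinator P H (bernsteinSymbol Lvy)) {s t : ℝ≥0} (hst : s < t) :
    ∀ᵐ ω ∂P, H s ω < H t ω := by
  have h1 := hH.stationary s (t - s)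
  rw [add_tsub_cancel_of_le hst.le] at h1
  have h2 := h1.symm.ae_mem_snd (t := Ioi 0) measurableSet_Ioi
    (hH.ae_pos hLvy (tsub_pos_of_lt hst))
  filter_upwards [h2] with ω hω using sub_pos.mp hω

theorem IsSubordinator.ae_strictMono (hLvy : IsInfiniteLevyMeasure Lvy)
    (hH : IsSubordinator P H (bernsteinSymbol Lvy)) :
    ∀ᵐ ω ∂P, StrictMono fun t => H t ω := by
  -- A countable dense set of times keeps the exceptional event null; monotone paths carry the
  -- strict inequality to all times.
  obtain ⟨D, hDc, hDd⟩ := TopologicalSpace.exists_countable_dense ℝ≥0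
  have h1 : ∀ᵐ ω ∂P, ∀ s ∈ D, ∀ t ∈ D, s < t → H s ω < H t ω := by
    rw [ae_ball_iff hDc]
    intro s _
    rw [ae_ball_iff hDc]
    intro t _
    by_cases hst : s < t
    · filter_upwards [hH.ae_lt hLvy hst] with ω hω _ using hω
    · exact Eventually.of_forall fun ω h => absurd h hst
  filter_upwards [h1, hH.mono] with ω hω hm s t hst
  obtain ⟨p, hpD, hsp, hpt⟩ := hDd.exists_between hst
  obtain ⟨q, hqD, hpq, hqt⟩ := hDd.exists_between hpt
  exact (hm hsp.le).trans_lt ((hω p hpD q hqD hpq).trans_le (hm hqt.le))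

end Subordinator

/-! ### Processes with strictly increasing paths and their inverses -/

/-- A nonnegative process all of whose paths start at `0`, increase strictly and tend to
infinity. -/
structure IsStrictlyIncreasingProcess (H : ℝ≥0 → Ω → ℝ) : Prop where
  measurable : ∀ t, Measurable (H t)
  start : ∀ ω, H 0 ω = 0
  strictMono : ∀ ω, StrictMono fun t => H t ω
  unbounded : ∀ ω, ∀ x : ℝ, ∃ t, x < H t ω

/-- On a measurable null set the path is replaced by $t\mapsto t$. The path properties then hold for
every $\omega$, so the inverse is jointly measurable without completing $P$, and $\varphi$ is
unchanged. -/
theorem IsSubordinator.exists_modification {Lvy : Measure ℝ} {H : ℝ≥0 → Ω → ℝ}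
    (hLvy : IsInfiniteLevyMeasure Lvy) (hH : IsSubordinator P H (bernsteinSymbol Lvy)) :
    ∃ K : ℝ≥0 → Ω → ℝ, IsStrictlyIncreasingProcess K ∧ ∀ᵐ ω ∂P, ∀ t, K t ω = H t ω := by
  classical
  have hgood : ∀ᵐ ω ∂P, H 0 ω = 0 ∧ (StrictMono fun t => H t ω) ∧
      ∀ x : ℝ, ∃ t, x < H t ω :=
    hH.start.and ((hH.ae_strictMono hLvy).and (hH.ae_unbounded hLvy))
  obtain ⟨N, hN, hNm, hN0⟩ := exists_measurable_superset_of_null (ae_iff.mp hgood)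
  have hout : ∀ ω, ω ∉ N → H 0 ω = 0 ∧ (StrictMono fun t => H t ω) ∧
      ∀ x : ℝ, ∃ t, x < H t ω := fun ω hω => by
    by_contra h
    exact hω (hN h)
  refine ⟨fun t ω => if ω ∈ N then (t : ℝ) else H t ω, ⟨fun t => ?_, fun ω => ?_,
    fun ω => ?_, fun ω => ?_⟩, ?_⟩
  · exact Measurable.ite hNm measurable_const (hH.measurable t)
  · by_cases h : ω ∈ N
    · simp [h]
    · simp [h, (hout ω h).1]
  · by_cases h : ω ∈ N
    · simp only [h, if_true]
      exact fun s t hst => NNReal.coe_lt_coe.mpr hst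
    · simpa [h] using (hout ω h).2.1
  · by_cases h : ω ∈ N
    · intro x
      obtain ⟨n, hn⟩ := exists_nat_gt x
      exact ⟨n, by simpa [h] using hn⟩
    · simpa [h] using (hout ω h).2.2
  · filter_upwards [measure_eq_zero_iff_ae_notMem.mp hN0] with ω hω t
    simp [hω]

namespace IsStrictlyIncreasingProcess

variable {K : ℝ≥0 → Ω → ℝ}

theorem nonneg (hK : IsStrictlyIncreasingProcess K) (t : ℝ≥0) (ω : Ω) : 0 ≤ K t ω := by
  rw [← hK.start ω]
  exact (hK.strictMono ω).monotone (zero_le (a := t))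

/-- Unboundedness excludes the default value `sInf ∅ = 0`. The strict $q<s$ matters: $t<K_s$ alone
yields only $L_t\le s$. -/
theorem inverse_lt_iff (hK : IsStrictlyIncreasingProcess K) {t : ℝ} {ω : Ω} {s : ℝ≥0} :
    inverseProcess K t ω < s ↔ ∃ q < s, t < K q ω := by
  rw [inverseProcess, csInf_lt_iff (s := {s : ℝ≥0 | t < K s ω}) (OrderBot.bddBelow _)
    (hK.unbounded ω t)]
  simp only [mem_ofPred_eq]
  exact ⟨fun ⟨q, h1, h2⟩ => ⟨q, h2, h1⟩, fun ⟨q, h1, h2⟩ => ⟨q, h2, h1⟩⟩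

theorem lt_of_inverse_lt (hK : IsStrictlyIncreasingProcess K) {t : ℝ} {ω : Ω} {s : ℝ≥0}
    (h : inverseProcess K t ω < s) : t < K s ω := by
  obtain ⟨q, hq, hqt⟩ := hK.inverse_lt_iff.mp h
  exact hqt.trans (hK.strictMono ω hq)

omit [MeasurableSpace Ω] in
theorem inverse_le {t : ℝ} {ω : Ω} {s : ℝ≥0}
    (h : t < K s ω) : inverseProcess K t ω ≤ s :=
  csInf_le (OrderBot.bddBelow _) h

omit [MeasurableSpace Ω] in
theorem le_of_lt_inverse {t : ℝ} {ω : Ω} {s : ℝ≥0}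
    (h : s < inverseProcess K t ω) : K s ω ≤ t :=
  not_lt.mp fun h' => absurd (inverse_le h') (not_le.mpr h)

theorem le_inverse (hK : IsStrictlyIncreasingProcess K) {t : ℝ} {ω : Ω} {s : ℝ≥0}
    (h : K s ω ≤ t) : s ≤ inverseProcess K t ω :=
  not_lt.mp fun h' => absurd (hK.lt_of_inverse_lt h') (not_lt.mpr h)

theorem inverse_zero (hK : IsStrictlyIncreasingProcess K) (ω : Ω) :
    inverseProcess K 0 ω = 0 := by
  refine le_antisymm (le_of_forall_gt fun s hs => ?_) (zero_le (a := _))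
  obtain ⟨q, hq0, hqs⟩ := exists_between hs
  refine hK.inverse_lt_iff.mpr ⟨q, hqs, ?_⟩
  rw [← hK.start ω]
  exact hK.strictMono ω hq0

theorem inverse_mono (hK : IsStrictlyIncreasingProcess K) (ω : Ω) :
    Monotone fun t => inverseProcess K t ω := by
  intro t t' h
  refine csInf_le_csInf (OrderBot.bddBelow _) (hK.unbounded ω t') fun s hs => ?_
  exact h.trans_lt hs

/-- A jump of the inverse would be an interval on which the path is constant. -/
theorem continuous_inverse (hK : IsStrictlyIncreasingProcess K) (ω : Ω) :
    Continuous fun t => inverseProcess K t ω := by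
  rw [continuous_iff_continuousAt]
  intro t
  rw [ContinuousAt, tendsto_order]
  constructor
  · intro s hs
    obtain ⟨s', hss', hs'⟩ := exists_between hs
    obtain ⟨s'', hs's'', hs''⟩ := exists_between hs'
    have h1 : K s' ω < t := (hK.strictMono ω hs's'').trans_le (le_of_lt_inverse hs'')
    filter_upwards [lt_mem_nhds h1] with x hx
    exact hss'.trans_le (hK.le_inverse hx.le)
  · intro s hs
    obtain ⟨q, hq, hqt⟩ := hK.inverse_lt_iff.mp hs
    filter_upwards [gt_mem_nhds hqt] with x hx
    exact hK.inverse_lt_iff.mpr ⟨q, hq, hx⟩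

theorem measurable_inverse (hK : IsStrictlyIncreasingProcess K) :
    Measurable fun p : ℝ × Ω => inverseProcess K p.1 p.2 := by
  obtain ⟨D, hDc, hDd⟩ := TopologicalSpace.exists_countable_dense ℝ≥0
  refine measurable_of_Iio fun s => ?_
  have : (fun p : ℝ × Ω => inverseProcess K p.1 p.2) ⁻¹' Iio s =
      ⋃ q ∈ D ∩ Iio s, {p : ℝ × Ω | p.1 < K q p.2} := by
    ext p
    simp only [mem_preimage, mem_Iio, hK.inverse_lt_iff, mem_iUnion, mem_ofPred_eq, mem_inter_iff,
      exists_prop]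
    constructor
    · rintro ⟨q, hqs, hq⟩
      obtain ⟨r, hrD, hqr, hrs⟩ := hDd.exists_between hqs
      exact ⟨r, ⟨hrD, hrs⟩, hq.trans (hK.strictMono _ hqr)⟩
    · rintro ⟨q, ⟨_, hqs⟩, hq⟩
      exact ⟨q, hqs, hq⟩
  rw [this]
  exact MeasurableSet.biUnion (hDc.mono inter_subset_left) fun q _ =>
    measurableSet_lt measurable_fst ((hK.measurable q).comp measurable_snd)

theorem measurable_inverse_right (hK : IsStrictlyIncreasingProcess K) (t : ℝ) :
    Measurable fun ω => inverseProcess K t ω :=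
  hK.measurable_inverse.comp measurable_prodMk_left

theorem integrable_exp_inverse (hK : IsStrictlyIncreasingProcess K) {θ : ℝ} (hθ : 0 ≤ θ)
    (t : ℝ) : Integrable (fun ω => Real.exp (-θ * (inverseProcess K t ω : ℝ))) P := by
  refine Integrable.of_bound
    (((hK.measurable_inverse_right t).coe_nnreal_real.const_mul _).exp.aestronglyMeasurable) 1
    (Eventually.of_forall fun ω => ?_)
  rw [Real.norm_of_nonneg (Real.exp_pos _).le, Real.exp_le_one_iff]
  have := (inverseProcess K t ω).coe_nonneg
  nlinarith

theorem continuous_inverseLaplace (hK : IsStrictlyIncreasingProcess K) {θ : ℝ} (hθ : 0 ≤ θ) :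
    Continuous (inverseLaplace P K θ) := by
  refine continuous_of_dominated (bound := fun _ => 1)
    (fun t => (hK.integrable_exp_inverse hθ t).aestronglyMeasurable)
    (fun t => Eventually.of_forall fun ω => ?_) (integrable_const _)
    (Eventually.of_forall fun ω => ?_)
  · rw [Real.norm_of_nonneg (Real.exp_pos _).le, Real.exp_le_one_iff]
    have := (inverseProcess K t ω).coe_nonneg
    nlinarith
  · have := hK.continuous_inverse ω
    fun_prop

theorem inverseLaplace_zero (hK : IsStrictlyIncreasingProcess K) (θ : ℝ) :
    inverseLaplace P K θ 0 = 1 := by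
  simp [inverseLaplace, hK.inverse_zero]

theorem antitone_inverseLaplace (hK : IsStrictlyIncreasingProcess K) {θ : ℝ} (hθ : 0 ≤ θ) :
    Antitone (inverseLaplace P K θ) := by
  intro s t hst
  refine integral_mono (hK.integrable_exp_inverse hθ t) (hK.integrable_exp_inverse hθ s)
    fun ω => Real.exp_le_exp.mpr ?_
  have : (inverseProcess K s ω : ℝ) ≤ inverseProcess K t ω := hK.inverse_mono ω hst
  nlinarith

omit [IsProbabilityMeasure P] in
theorem inverseLaplace_nonneg (K : ℝ≥0 → Ω → ℝ) (θ t : ℝ) :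
    0 ≤ inverseLaplace P K θ t :=
  integral_nonneg fun _ => (Real.exp_pos _).le

end IsStrictlyIncreasingProcess

omit [IsProbabilityMeasure P] in
theorem inverseLaplace_congr {H K : ℝ≥0 → Ω → ℝ} (h : ∀ᵐ ω ∂P, ∀ t, K t ω = H t ω) (θ : ℝ) :
    inverseLaplace P H θ = inverseLaplace P K θ := by
  funext t
  refine integral_congr_ae ?_
  filter_upwards [h] with ω hω
  simp only [inverseProcess, hω]

/-! ### The Laplace transform of $\varphi$ by exponential times -/

theorem integral_expMeasure {r : ℝ} (hr : 0 < r) (f : ℝ → ℝ) :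
    ∫ t, f t ∂expMeasure r = r * ∫ t in Ioi 0, Real.exp (-r * t) * f t := by
  have h1 : expMeasure r = volume.withDensity fun t => ENNReal.ofReal (exponentialPDFReal r t) := rfl
  rw [h1, integral_withDensity_eq_integral_toReal_smul
    (measurable_exponentialPDFReal r).ennreal_ofReal
    (Eventually.of_forall fun _ => ENNReal.ofReal_lt_top), ← integral_const_mul,
    ← integral_Ici_eq_integral_Ioi, ← integral_indicator measurableSet_Ici]
  refine integral_congr_ae (Eventually.of_forall fun t => ?_)
  by_cases ht : 0 ≤ t
  · simp only [indicator, mem_Ici, ht, if_true]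
    have := exponentialPDF_of_nonneg (r := r) ht
    rw [exponentialPDF] at this
    rw [this, ENNReal.toReal_ofReal (by positivity), smul_eq_mul,
      neg_mul, mul_assoc]
  · simp only [indicator, mem_Ici, ht, if_false]
    have := exponentialPDF_of_neg (r := r) (not_le.mp ht)
    rw [exponentialPDF] at this
    rw [this]
    simp

theorem real_expMeasure_Ioi {r x : ℝ} (hr : 0 < r) (hx : 0 ≤ x) :
    (expMeasure r).real (Ioi x) = Real.exp (-r * x) := by
  have := isProbabilityMeasure_expMeasure hr
  have h := cdf_expMeasure_eq hr x
  rw [cdf_eq_real, if_pos hx] at h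
  rw [← compl_Iic, measureReal_compl measurableSet_Iic, h]
  simp [neg_mul]

theorem real_expMeasure_Iio {r x : ℝ} (hr : 0 < r) (hx : 0 ≤ x) :
    (expMeasure r).real (Iio x) = 1 - Real.exp (-r * x) := by
  have := isProbabilityMeasure_expMeasure hr
  have h := cdf_expMeasure_eq hr x
  rw [cdf_eq_real, if_pos hx] at h
  have hz : expMeasure r {x} = 0 :=
    (withDensity_absolutelyContinuous volume (exponentialPDF r)) (measure_singleton x)
  rw [← neg_mul] at h
  rw [← h]
  exact measureReal_congr (Iio_ae_eq_Iic' hz)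

theorem real_prod_eq_integral_left {α β : Type*} [MeasurableSpace α] [MeasurableSpace β]
    {μ : Measure α} {ν : Measure β} [IsFiniteMeasure μ] [IsFiniteMeasure ν] {s : Set (α × β)}
    (hs : MeasurableSet s) :
    (μ.prod ν).real s = ∫ x, ν.real {y | (x, y) ∈ s} ∂μ := by
  rw [← integral_indicator_one hs, integral_prod _ ((integrable_const 1).indicator hs)]
  refine integral_congr_ae (Eventually.of_forall fun x => ?_)
  exact integral_indicator_one (measurable_prodMk_left hs)

theorem real_prod_eq_integral_right {α β : Type*} [MeasurableSpace α] [MeasurableSpace β]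
    {μ : Measure α} {ν : Measure β} [IsFiniteMeasure μ] [IsFiniteMeasure ν] {s : Set (α × β)}
    (hs : MeasurableSet s) :
    (μ.prod ν).real s = ∫ y, μ.real {x | (x, y) ∈ s} ∂ν := by
  rw [← integral_indicator_one hs, integral_prod_symm _ ((integrable_const 1).indicator hs)]
  refine integral_congr_ae (Eventually.of_forall fun x => ?_)
  exact integral_indicator_one (measurable_prodMk_right hs)

namespace IsStrictlyIncreasingProcess

variable {K : ℝ≥0 → Ω → ℝ} {Φ : ℝ → ℝ}

theorem real_prod_lt (hK : IsStrictlyIncreasingProcess K)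
    (hlap : ∀ (t : ℝ≥0) (lam : ℝ), 0 < lam →
      ∫ ω, Real.exp (-lam * K t ω) ∂P = Real.exp (-(t : ℝ) * Φ lam))
    {lam : ℝ} (hl : 0 < lam) (q : ℝ≥0) :
    ((expMeasure lam).prod P).real {p | p.1 < K q p.2} = 1 - Real.exp (-(q : ℝ) * Φ lam) := by
  have := isProbabilityMeasure_expMeasure hl
  rw [real_prod_eq_integral_right (s := {p : ℝ × Ω | p.1 < K q p.2})
    (measurableSet_lt measurable_fst ((hK.measurable q).comp measurable_snd)), ← hlap q lam hl]
  have : ∀ ω, (expMeasure lam).real {x | (x, ω) ∈ {p : ℝ × Ω | p.1 < K q p.2}} =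
      1 - Real.exp (-lam * K q ω) := fun ω => by
    have hset : {x | (x, ω) ∈ {p : ℝ × Ω | p.1 < K q p.2}} = Iio (K q ω) := by
      ext x
      simp only [mem_ofPred_eq, mem_Iio]
    rw [hset, real_expMeasure_Iio hl (hK.nonneg q ω)]
  simp_rw [this]
  rw [integral_sub (integrable_const 1)]
  · simp
  · have hm := hK.measurable q
    refine Integrable.of_bound (by fun_prop) 1
      (Eventually.of_forall fun ω => ?_)
    rw [Real.norm_of_nonneg (Real.exp_pos _).le, Real.exp_le_one_iff]
    nlinarith [hK.nonneg q ω]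

theorem real_prod_inverse_lt (hK : IsStrictlyIncreasingProcess K)
    (hlap : ∀ (t : ℝ≥0) (lam : ℝ), 0 < lam →
      ∫ ω, Real.exp (-lam * K t ω) ∂P = Real.exp (-(t : ℝ) * Φ lam))
    {lam : ℝ} (hl : 0 < lam) (s : ℝ≥0) :
    ((expMeasure lam).prod P).real {p | inverseProcess K p.1 p.2 < s} =
      1 - Real.exp (-(s : ℝ) * Φ lam) := by
  have := isProbabilityMeasure_expMeasure hl
  refine le_antisymm ?_ ?_
  · rw [← hK.real_prod_lt hlap hl s]
    exact measureReal_mono fun p hp => hK.lt_of_inverse_lt hp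
  · rcases eq_or_ne s 0 with rfl | hs
    · simp
    -- For $q<s$ the event $\tau<K_q$ lies in $L_\tau<s$. The points $q=s\,n/(n+1)$ increase to $s$,
    -- and the explicit probabilities are continuous in $q$.
    have hq : Tendsto (fun n : ℕ => (s : ℝ) * ((n : ℝ) / (n + 1))) atTop (nhds s) := by
      simpa using (tendsto_natCast_div_add_atTop (1 : ℝ)).const_mul (s : ℝ)
    have hlim : Tendsto (fun n : ℕ => 1 - Real.exp (-((s : ℝ) * ((n : ℝ) / (n + 1))) * Φ lam))
        atTop (nhds (1 - Real.exp (-(s : ℝ) * Φ lam))) :=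
      (Real.continuous_exp.tendsto _ |>.comp (hq.neg.mul_const _)).const_sub 1
    refine le_of_tendsto' hlim fun n => ?_
    have h1 := hK.real_prod_lt hlap hl (s * ((n : ℝ≥0) / (n + 1)))
    push_cast at h1
    rw [← h1]
    refine measureReal_mono fun p hp => lt_of_le_of_lt (inverse_le hp) ?_
    refine mul_lt_of_lt_one_right (pos_iff_ne_zero.mpr hs) ?_
    rw [div_lt_one (by positivity)]
    exact lt_add_one _

/-- Both sides are the probability of $L_\tau<\sigma$ under the product law: fixing $(\tau,\omega)$
gives $e^{-\theta L_\tau}$, fixing $\sigma=s$ gives $1-e^{-s\Phi(\lambda)}$. -/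
theorem integral_expMeasure_inverseLaplace (hK : IsStrictlyIncreasingProcess K)
    (hlap : ∀ (t : ℝ≥0) (lam : ℝ), 0 < lam →
      ∫ ω, Real.exp (-lam * K t ω) ∂P = Real.exp (-(t : ℝ) * Φ lam))
    {θ lam : ℝ} (hθ : 0 < θ) (hl : 0 < lam) :
    ∫ t, inverseLaplace P K θ t ∂expMeasure lam =
      ∫ s, (1 - Real.exp (-s * Φ lam)) ∂expMeasure θ := by
  have := isProbabilityMeasure_expMeasure hl
  have := isProbabilityMeasure_expMeasure hθ
  set S : Set ((ℝ × Ω) × ℝ) := {p | (inverseProcess K p.1.1 p.1.2 : ℝ) < p.2} with hSdef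
  have hS : MeasurableSet S :=
    measurableSet_lt (hK.measurable_inverse.coe_nnreal_real.comp measurable_fst) measurable_snd
  have h1 : ∫ t, inverseLaplace P K θ t ∂expMeasure lam =
      (((expMeasure lam).prod P).prod (expMeasure θ)).real S := by
    rw [real_prod_eq_integral_left hS]
    have h2 : ∀ p : ℝ × Ω, (expMeasure θ).real {s | (p, s) ∈ S} =
        Real.exp (-θ * (inverseProcess K p.1 p.2 : ℝ)) := fun p => by
      have hset : {s | (p, s) ∈ S} = Ioi (inverseProcess K p.1 p.2 : ℝ) := by
        ext x
        simp only [hSdef, mem_ofPred_eq, mem_Ioi]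
      rw [hset, real_expMeasure_Ioi hθ (NNReal.coe_nonneg _)]
    simp_rw [h2]
    refine (integral_prod (fun p : ℝ × Ω => Real.exp (-θ * (inverseProcess K p.1 p.2 : ℝ))) ?_).symm
    · have hm : Measurable fun p : ℝ × Ω =>
          Real.exp (-θ * (inverseProcess K p.1 p.2 : ℝ)) :=
        (hK.measurable_inverse.coe_nnreal_real.const_mul (-θ)).exp
      refine Integrable.of_bound hm.aestronglyMeasurable 1
        (Eventually.of_forall fun p => ?_)
      rw [Real.norm_of_nonneg (Real.exp_pos _).le, Real.exp_le_one_iff]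
      have := (inverseProcess K p.1 p.2).coe_nonneg
      nlinarith
  rw [h1, real_prod_eq_integral_right hS]
  refine integral_congr_ae ?_
  have hpos : ∀ᵐ s ∂expMeasure θ, 0 ≤ s := by
    have h3 : (expMeasure θ).real (Iio 0) = 0 := by
      rw [real_expMeasure_Iio hθ le_rfl]; simp
    filter_upwards [measure_eq_zero_iff_ae_notMem.mp ((measureReal_eq_zero_iff).mp h3)] with s hs
    exact not_lt.mp hs
  filter_upwards [hpos] with s hs
  lift s to ℝ≥0 using hs
  have hset : {p : ℝ × Ω | (p, (s : ℝ)) ∈ S} = {p | inverseProcess K p.1 p.2 < s} := by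
    ext p
    simp only [hSdef, mem_ofPred_eq, NNReal.coe_lt_coe]
  rw [hset, hK.real_prod_inverse_lt hlap hl s]

theorem integral_exp_mul_inverseLaplace (hK : IsStrictlyIncreasingProcess K)
    (hlap : ∀ (t : ℝ≥0) (lam : ℝ), 0 < lam →
      ∫ ω, Real.exp (-lam * K t ω) ∂P = Real.exp (-(t : ℝ) * Φ lam))
    {θ lam : ℝ} (hθ : 0 < θ) (hl : 0 < lam) (hΦ : 0 < Φ lam) :
    ∫ t in Ioi 0, Real.exp (-lam * t) * inverseLaplace P K θ t =
      Φ lam / (lam * (θ + Φ lam)) := by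
  have h1 := hK.integral_expMeasure_inverseLaplace hlap hθ hl
  have h3 : ∀ t : ℝ, Real.exp (-θ * t) * (1 - Real.exp (-t * Φ lam)) =
      Real.exp (-θ * t) - Real.exp (-(θ + Φ lam) * t) := fun t => by
    rw [mul_sub, mul_one, ← Real.exp_add]; ring_nf
  rw [integral_expMeasure hl, integral_expMeasure hθ] at h1
  simp_rw [h3] at h1
  rw [integral_sub (integrableOn_exp_mul_Ioi (by linarith) 0)
    (integrableOn_exp_mul_Ioi (by linarith) 0), integral_exp_mul_Ioi (by linarith),
    integral_exp_mul_Ioi (by linarith)] at h1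
  simp only [mul_zero, Real.exp_zero] at h1
  rw [eq_div_iff (by positivity), mul_comm, mul_right_comm, h1]
  field_simp
  ring

end IsStrictlyIncreasingProcess

end StrictlyIncreasing

/-! ### Convolution on the half-line -/

open scoped Convolution

/-- `f` is integrable on every bounded interval `(0, b]`. -/
def IsHalfLineLocallyIntegrable (f : ℝ → ℝ) : Prop :=
  ∀ b : ℝ, IntegrableOn f (Ioc 0 b)

/-- The convolution of two functions on `(0, ∞)`. -/
noncomputable def causalConv (f g : ℝ → ℝ) (t : ℝ) : ℝ :=
  ∫ s in Ioo 0 t, f s * g (t - s)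

theorem IsHalfLineLocallyIntegrable.trunc {f : ℝ → ℝ} (hf : IsHalfLineLocallyIntegrable f)
    (b : ℝ) : Integrable ((Ioc 0 b).indicator f) :=
  (hf b).integrable_indicator measurableSet_Ioc

/-- The convolution at $t\le b$ sees only values on $(0,b]$. Truncation thus reduces locally
integrable factors to integrable functions on the line. -/
theorem trunc_mul_trunc (f g : ℝ → ℝ) {t b : ℝ} (h : t ≤ b) (s : ℝ) :
    (Ioc 0 b).indicator f s * (Ioc 0 b).indicator g (t - s) =
      (Ioo 0 t).indicator (fun s => f s * g (t - s)) s := by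
  by_cases hs : s ∈ Ioo 0 t
  · rw [indicator_of_mem hs, indicator_of_mem (show s ∈ Ioc 0 b from ⟨hs.1, by linarith [hs.2]⟩),
      indicator_of_mem (show t - s ∈ Ioc 0 b from ⟨by linarith [hs.2], by linarith [hs.1]⟩)]
  · rw [indicator_of_notMem hs]
    by_cases h0 : 0 < s
    · rw [indicator_of_notMem (show t - s ∉ Ioc 0 b from fun hm => hs ⟨h0, by linarith [hm.1]⟩),
        mul_zero]
    · rw [indicator_of_notMem (show s ∉ Ioc 0 b from fun hm => h0 hm.1), zero_mul]

theorem convolution_trunc (f g : ℝ → ℝ) {t b : ℝ} (h : t ≤ b) :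
    ((Ioc 0 b).indicator f ⋆[ContinuousLinearMap.mul ℝ ℝ, volume] (Ioc 0 b).indicator g) t =
      causalConv f g t := by
  rw [causalConv, ← integral_indicator measurableSet_Ioo, convolution]
  simp only [ContinuousLinearMap.mul_apply', trunc_mul_trunc f g h]

theorem causalConv_of_nonpos (f g : ℝ → ℝ) {t : ℝ} (h : t ≤ 0) : causalConv f g t = 0 := by
  simp [causalConv, Ioo_eq_empty (not_lt.mpr h)]

theorem causalConv_comm (f g : ℝ → ℝ) (t : ℝ) : causalConv f g t = causalConv g f t := by
  rw [causalConv, causalConv, ← integral_indicator measurableSet_Ioo,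
    ← integral_indicator measurableSet_Ioo]
  rw [← integral_sub_left_eq_self _ volume t]
  congr 1
  funext s
  by_cases hs : s ∈ Ioo 0 t
  · rw [indicator_of_mem hs, indicator_of_mem
      (show t - s ∈ Ioo 0 t from ⟨by linarith [hs.2], by linarith [hs.1]⟩), sub_sub_cancel,
      mul_comm]
  · rw [indicator_of_notMem hs, indicator_of_notMem
      (show t - s ∉ Ioo 0 t from fun h => hs ⟨by linarith [h.2], by linarith [h.1]⟩)]

theorem causalConv_congr_left {f f' : ℝ → ℝ} (h : ∀ᵐ t ∂volume, t ∈ Ioi (0 : ℝ) → f t = f' t)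
    (g : ℝ → ℝ) (t : ℝ) : causalConv f g t = causalConv f' g t := by
  refine setIntegral_congr_ae measurableSet_Ioo ?_
  filter_upwards [h] with s hs hst
  rw [hs hst.1]

theorem causalConv_congr_right {g g' : ℝ → ℝ} (h : ∀ᵐ t ∂volume, t ∈ Ioi (0 : ℝ) → g t = g' t)
    (f : ℝ → ℝ) (t : ℝ) : causalConv f g t = causalConv f g' t := by
  rw [causalConv_comm, causalConv_congr_left h, causalConv_comm]

theorem ae_of_forall_nat_ae_le {p : ℝ → Prop}
    (h : ∀ b : ℕ, ∀ᵐ t : ℝ, t ≤ (b : ℝ) → p t) : ∀ᵐ t : ℝ, p t := by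
  filter_upwards [ae_all_iff.mpr h] with t ht
  obtain ⟨n, hn⟩ := exists_nat_ge t
  exact ht n hn

namespace IsHalfLineLocallyIntegrable

variable {f g k : ℝ → ℝ}

theorem ae_integrableOn_mul (hf : IsHalfLineLocallyIntegrable f)
    (hg : IsHalfLineLocallyIntegrable g) :
    ∀ᵐ t : ℝ, IntegrableOn (fun s => f s * g (t - s)) (Ioo 0 t) := by
  refine ae_of_forall_nat_ae_le fun b => ?_
  filter_upwards [(hf.trunc b).ae_convolution_exists (ContinuousLinearMap.mul ℝ ℝ)
    (hg.trunc b)] with t ht htb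
  rw [ConvolutionExistsAt] at ht
  simp only [ContinuousLinearMap.mul_apply', trunc_mul_trunc f g htb] at ht
  exact (integrable_indicator_iff measurableSet_Ioo).mp ht

theorem conv (hf : IsHalfLineLocallyIntegrable f) (hg : IsHalfLineLocallyIntegrable g) :
    IsHalfLineLocallyIntegrable (causalConv f g) := by
  intro b
  have h := ((hf.trunc b).integrable_convolution (ContinuousLinearMap.mul ℝ ℝ)
    (hg.trunc b)).integrableOn (s := Ioc 0 b)
  refine h.congr_fun (fun t ht => ?_) measurableSet_Ioc
  exact convolution_trunc f g ht.2

theorem add (hf : IsHalfLineLocallyIntegrable f) (hg : IsHalfLineLocallyIntegrable g) :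
    IsHalfLineLocallyIntegrable fun t => f t + g t :=
  fun b => (hf b).add (hg b)

theorem causalConv_assoc (hf : IsHalfLineLocallyIntegrable f)
    (hg : IsHalfLineLocallyIntegrable g) (hk : IsHalfLineLocallyIntegrable k) :
    ∀ᵐ t : ℝ,
      causalConv (causalConv f g) k t =
        causalConv f (causalConv g k) t := by
  refine ae_of_forall_nat_ae_le fun b => ?_
  -- `convolution_assoc` asks for existence of the convolutions of absolute values, the Fubini
  -- condition.
  have hnorm : ∀ {u : ℝ → ℝ}, IsHalfLineLocallyIntegrable u →
      Integrable fun t => ‖(Ioc 0 (b : ℝ)).indicator u t‖ := fun hu => (hu.trunc b).norm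
  have hgk := (hnorm hg).integrable_convolution (ContinuousLinearMap.mul ℝ ℝ) (hnorm hk)
  filter_upwards [(hnorm hf).ae_convolution_exists (ContinuousLinearMap.mul ℝ ℝ) hgk]
    with t ht htb
  have hassoc := convolution_assoc (ContinuousLinearMap.mul ℝ ℝ) (ContinuousLinearMap.mul ℝ ℝ)
    (ContinuousLinearMap.mul ℝ ℝ) (ContinuousLinearMap.mul ℝ ℝ)
    (fun x y z => by simp [mul_assoc]) (x₀ := t)
    (hf.trunc b).aestronglyMeasurable (hg.trunc b).aestronglyMeasurable
    (hk.trunc b).aestronglyMeasurable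
    ((hf.trunc b).ae_convolution_exists (ContinuousLinearMap.mul ℝ ℝ) (hg.trunc b))
    ((hnorm hg).ae_convolution_exists (ContinuousLinearMap.mul ℝ ℝ) (hnorm hk)) ht
  -- The inner convolution of truncations may differ from `causalConv` beyond $b$, but only
  -- arguments $t-s<b$ occur.
  have h1 : ∀ {u v w : ℝ → ℝ}, ∀ s, (Ioc 0 (b : ℝ)).indicator u s *
      ((Ioc 0 (b : ℝ)).indicator v ⋆[ContinuousLinearMap.mul ℝ ℝ, volume]
        (Ioc 0 (b : ℝ)).indicator w) (t - s) =
      (Ioo 0 t).indicator (fun s => u s * causalConv v w (t - s)) s := by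
    intro u v w s
    by_cases h0 : 0 < s
    · rw [convolution_trunc v w (by linarith : t - s ≤ b), ← trunc_mul_trunc _ _ htb]
      congr 1
      by_cases hts : 0 < t - s
      · rw [indicator_of_mem (show t - s ∈ Ioc 0 (b : ℝ) from ⟨hts, by linarith⟩)]
      · rw [causalConv_of_nonpos _ _ (not_lt.mp hts), indicator_of_notMem fun hm => hts hm.1]
    · rw [indicator_of_notMem fun hm => h0 hm.1, zero_mul,
        indicator_of_notMem fun hm => h0 hm.1]
  have h2 : ((Ioc 0 (b : ℝ)).indicator f ⋆[ContinuousLinearMap.mul ℝ ℝ, volume]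
      ((Ioc 0 (b : ℝ)).indicator g ⋆[ContinuousLinearMap.mul ℝ ℝ, volume]
        (Ioc 0 (b : ℝ)).indicator k)) t = causalConv f (causalConv g k) t := by
    rw [causalConv, ← integral_indicator measurableSet_Ioo, convolution]
    simp only [ContinuousLinearMap.mul_apply', h1]
  have h3 : (((Ioc 0 (b : ℝ)).indicator f ⋆[ContinuousLinearMap.mul ℝ ℝ, volume]
      (Ioc 0 (b : ℝ)).indicator g) ⋆[ContinuousLinearMap.mul ℝ ℝ, volume]
        (Ioc 0 (b : ℝ)).indicator k) t = causalConv (causalConv f g) k t := by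
    rw [causalConv_comm, causalConv, ← integral_indicator measurableSet_Ioo, convolution,
      ← integral_sub_left_eq_self _ volume t]
    simp only [ContinuousLinearMap.mul_apply', sub_sub_cancel]
    simp only [mul_comm _ ((Ioc 0 (b : ℝ)).indicator k _), h1]
  rw [← h2, ← h3, hassoc]

end IsHalfLineLocallyIntegrable

/-! ### Laplace transforms of convolutions -/

section Laplace

variable {f g : ℝ → ℝ} {lam : ℝ}

theorem isHalfLineLocallyIntegrable_of_exp_mul
    (hf : IntegrableOn (fun t => Real.exp (-lam * t) * f t) (Ioi 0)) :
    IsHalfLineLocallyIntegrable f := by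
  intro b
  have h1 := hf.mono_set (Ioc_subset_Ioi_self : Ioc 0 b ⊆ Ioi 0)
  have h2 := h1.continuousOn_mul_of_subset (g := fun t => Real.exp (lam * t)) (K := Icc 0 b)
    (by fun_prop) isCompact_Icc measurableSet_Ioc Ioc_subset_Icc_self
  refine h2.congr_fun (fun t _ => ?_) measurableSet_Ioc
  simp only
  rw [← mul_assoc, ← Real.exp_add]
  simp

/-- As $e^{-\lambda t}=e^{-\lambda s}e^{-\lambda(t-s)}$, exponential weights pass to the factors,
and the transform of a convolution reduces to its plain integral. -/
theorem exp_mul_causalConv (f g : ℝ → ℝ) (lam t : ℝ) :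
    causalConv (fun t => Real.exp (-lam * t) * f t) (fun t => Real.exp (-lam * t) * g t) t =
      Real.exp (-lam * t) * causalConv f g t := by
  rw [causalConv, causalConv, ← integral_const_mul]
  congr 1
  funext s
  have : Real.exp (-lam * t) = Real.exp (-lam * s) * Real.exp (-lam * (t - s)) := by
    rw [← Real.exp_add]; ring_nf
  rw [this]
  ring

theorem convolution_indicator_Ioi (f g : ℝ → ℝ) (t : ℝ) :
    ((Ioi 0).indicator f ⋆[ContinuousLinearMap.mul ℝ ℝ, volume] (Ioi 0).indicator g) t =
      (Ioi 0).indicator (causalConv f g) t := by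
  have h1 : ∀ s, (Ioi 0).indicator f s * (Ioi 0).indicator g (t - s) =
      (Ioo 0 t).indicator (fun s => f s * g (t - s)) s := by
    intro s
    simp only [indicator, mem_Ioi, mem_Ioo, sub_pos, ite_mul, zero_mul, mul_ite, mul_zero]
    split_ifs <;> simp_all
  have h2 : ((Ioi 0).indicator f ⋆[ContinuousLinearMap.mul ℝ ℝ, volume] (Ioi 0).indicator g) t =
      causalConv f g t := by
    rw [causalConv, ← integral_indicator measurableSet_Ioo, convolution]
    simp only [ContinuousLinearMap.mul_apply', h1]
  rw [h2]
  by_cases ht : 0 < t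
  · rw [indicator_of_mem (show t ∈ Ioi 0 from ht)]
  · rw [indicator_of_notMem (show t ∉ Ioi 0 from ht), causalConv_of_nonpos _ _ (not_lt.mp ht)]

theorem integrableOn_causalConv (hf : IntegrableOn f (Ioi 0)) (hg : IntegrableOn g (Ioi 0)) :
    IntegrableOn (causalConv f g) (Ioi 0) := by
  rw [← integrable_indicator_iff measurableSet_Ioi] at hf hg ⊢
  exact (hf.integrable_convolution (ContinuousLinearMap.mul ℝ ℝ) hg).congr
    (Eventually.of_forall (convolution_indicator_Ioi f g))

theorem integral_causalConv (hf : IntegrableOn f (Ioi 0)) (hg : IntegrableOn g (Ioi 0)) :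
    ∫ t in Ioi 0, causalConv f g t = (∫ t in Ioi 0, f t) * ∫ t in Ioi 0, g t := by
  rw [← integrable_indicator_iff measurableSet_Ioi] at hf hg
  simp_rw [← integral_indicator (measurableSet_Ioi (a := (0 : ℝ)))]
  have := integral_convolution (ContinuousLinearMap.mul ℝ ℝ) hf hg
  simp only [convolution_indicator_Ioi] at this
  exact this

theorem integrableOn_exp_mul_causalConv
    (hf : IntegrableOn (fun t => Real.exp (-lam * t) * f t) (Ioi 0))
    (hg : IntegrableOn (fun t => Real.exp (-lam * t) * g t) (Ioi 0)) :
    IntegrableOn (fun t => Real.exp (-lam * t) * causalConv f g t) (Ioi 0) :=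
  (integrableOn_causalConv hf hg).congr_fun (fun t _ => exp_mul_causalConv f g lam t)
    measurableSet_Ioi

theorem integral_exp_mul_causalConv
    (hf : IntegrableOn (fun t => Real.exp (-lam * t) * f t) (Ioi 0))
    (hg : IntegrableOn (fun t => Real.exp (-lam * t) * g t) (Ioi 0)) :
    ∫ t in Ioi 0, Real.exp (-lam * t) * causalConv f g t =
      (∫ t in Ioi 0, Real.exp (-lam * t) * f t) * ∫ t in Ioi 0, Real.exp (-lam * t) * g t := by
  simpa only [exp_mul_causalConv] using integral_causalConv hf hg

end Laplace

/-! ### The weak equation as an identity between convolutions -/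

section Pairing

variable {f k w : ℝ → ℝ}

theorem IsHalfLineLocallyIntegrable.integrable_trunc_mul
    (hf : IsHalfLineLocallyIntegrable f) (hk : IsHalfLineLocallyIntegrable k)
    (hw : Continuous w) (hwc : HasCompactSupport w) (b : ℝ) :
    Integrable (fun p : ℝ × ℝ => w p.1 * ((Ioc 0 b).indicator f p.2 *
      (Ioc 0 b).indicator k (p.1 - p.2))) (volume.prod volume) := by
  obtain ⟨C, hC⟩ := hwc.exists_bound_of_continuous hw
  exact Integrable.bdd_mul (c := C)
    ((hf.trunc b).convolution_integrand (ContinuousLinearMap.mul ℝ ℝ) (hk.trunc b))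
    (by fun_prop) (Eventually.of_forall fun p => hC p.1)

theorem eq_zero_of_lt_of_tsupport {w : ℝ → ℝ} (hwc : HasCompactSupport w) :
    ∃ b, ∀ t, b < t → w t = 0 := by
  obtain ⟨b, hb⟩ := hwc.bddAbove
  exact ⟨b, fun t ht => image_eq_zero_of_notMem_tsupport
    fun h => absurd (hb h) (not_le.mpr ht)⟩

theorem integral_trunc_mul_eq {b : ℝ} (hb : ∀ t, b < t → w t = 0) (s : ℝ) :
    ∫ t, w t * ((Ioc 0 b).indicator f s * (Ioc 0 b).indicator k (t - s)) =
      (Ioi 0).indicator (fun s => f s * ∫ r in Ioi 0, k r * w (s + r)) s := by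
  by_cases hs : 0 < s
  · rw [indicator_of_mem (show s ∈ Ioi 0 from hs), ← integral_const_mul,
      ← integral_indicator measurableSet_Ioi, ← integral_add_right_eq_self _ s]
    congr 1
    funext r
    by_cases hr : 0 < r
    · rw [indicator_of_mem (show r ∈ Ioi 0 from hr), add_sub_cancel_right, add_comm s r]
      by_cases h : r + s ≤ b
      · rw [indicator_of_mem (show s ∈ Ioc 0 b from ⟨hs, by linarith⟩),
          indicator_of_mem (show r ∈ Ioc 0 b from ⟨hr, by linarith⟩)]
        ring
      · rw [hb _ (not_le.mp h)]
        ring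
    · rw [indicator_of_notMem (show r ∉ Ioi 0 from hr), add_sub_cancel_right,
        indicator_of_notMem (show r ∉ Ioc 0 b from fun h => hr h.1)]
      ring
  · rw [indicator_of_notMem (show s ∉ Ioi 0 from hs),
      indicator_of_notMem (show s ∉ Ioc 0 b from fun h => hs h.1)]
    simp

/-- Fubini with $t=s+r$: `reflConv` is adjoint to convolution. The compact support of $w$ permits
truncating both factors. -/
theorem IsHalfLineLocallyIntegrable.integral_mul_integral
    (hf : IsHalfLineLocallyIntegrable f) (hk : IsHalfLineLocallyIntegrable k)
    (hw : Continuous w) (hwc : HasCompactSupport w) :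
    ∫ s in Ioi 0, f s * ∫ r in Ioi 0, k r * w (s + r) =
      ∫ t in Ioi 0, w t * causalConv f k t := by
  obtain ⟨b, hb⟩ := eq_zero_of_lt_of_tsupport hwc
  rw [← integral_indicator measurableSet_Ioi, ← integral_indicator measurableSet_Ioi]
  simp only [← integral_trunc_mul_eq (f := f) (k := k) hb]
  rw [← integral_integral_swap (f := fun t s => w t * ((Ioc 0 b).indicator f s *
      (Ioc 0 b).indicator k (t - s))) (hf.integrable_trunc_mul hk hw hwc b)]
  congr 1
  funext t
  rw [integral_const_mul]
  by_cases ht : 0 < t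
  · rw [indicator_of_mem (show t ∈ Ioi 0 from ht)]
    by_cases h : t ≤ b
    · rw [← convolution_trunc f k h]
      rfl
    · rw [hb t (not_le.mp h), zero_mul, zero_mul]
  · rw [indicator_of_notMem (show t ∉ Ioi 0 from ht)]
    have : ∀ s, (Ioc 0 b).indicator f s * (Ioc 0 b).indicator k (t - s) = 0 := by
      intro s
      by_cases hs : 0 < s
      · rw [indicator_of_notMem (show t - s ∉ Ioc 0 b from fun h => ht (by linarith [h.1])),
          mul_zero]
      · rw [indicator_of_notMem (show s ∉ Ioc 0 b from fun h => hs h.1), zero_mul]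
    simp [this]

end Pairing

theorem ContinuousOn.isHalfLineLocallyIntegrable {f : ℝ → ℝ} (hf : ContinuousOn f (Ici 0)) :
    IsHalfLineLocallyIntegrable f := fun _ =>
  ((hf.mono Icc_subset_Ici_self).integrableOn_compact isCompact_Icc).mono_set Ioc_subset_Icc_self

theorem IsHalfLineLocallyIntegrable.integrableOn_mul {h w : ℝ → ℝ}
    (hh : IsHalfLineLocallyIntegrable h) (hw : Continuous w) (hwc : HasCompactSupport w) :
    IntegrableOn (fun t => w t * h t) (Ioi 0) := by
  obtain ⟨b, hb⟩ := eq_zero_of_lt_of_tsupport hwc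
  obtain ⟨C, hC⟩ := hwc.exists_bound_of_continuous hw
  rw [← integrable_indicator_iff measurableSet_Ioi]
  refine (Integrable.bdd_mul (c := C) (hh.trunc b) hw.aestronglyMeasurable
    (Eventually.of_forall hC)).congr (Eventually.of_forall fun t => ?_)
  by_cases h0 : 0 < t
  · by_cases htb : t ≤ b
    · simp [indicator, h0, htb]
    · simp [indicator, h0, hb t (not_le.mp htb)]
  · simp [indicator, h0]

theorem IsHalfLineLocallyIntegrable.locallyIntegrableOn {h : ℝ → ℝ}
    (hh : IsHalfLineLocallyIntegrable h) : LocallyIntegrableOn h (Ioi 0) := fun x hx =>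
  ⟨Ioc 0 (x + 1), mem_nhdsWithin_of_mem_nhds (Ioc_mem_nhds hx (by linarith)), hh _⟩

/-- Differentiation under the integral falls on $\eta$, since $\kappa$ is merely locally integrable.
For $s>0$ the integrand vanishes once $r$ exceeds the supports of $\eta$ and $\eta'$. -/
theorem hasDerivAt_reflConv {κ η : ℝ → ℝ} (hκ : IsHalfLineLocallyIntegrable κ)
    (hη : ContDiff ℝ (⊤ : ℕ∞) η) (hηc : HasCompactSupport η) {s : ℝ} (hs : 0 < s) :
    HasDerivAt (reflConv κ η) (∫ r in Ioi 0, κ r * deriv η (s + r)) s := by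
  obtain ⟨b, hb⟩ := eq_zero_of_lt_of_tsupport hηc
  obtain ⟨b', hb'⟩ := eq_zero_of_lt_of_tsupport hηc.deriv
  set B := max b b'
  have hd : Continuous (deriv η) := hη.continuous_deriv (by simp)
  obtain ⟨C, hC⟩ := hηc.deriv.exists_bound_of_continuous hd
  obtain ⟨C', hC'⟩ := hηc.exists_bound_of_continuous hη.continuous
  have hint : ∀ {w : ℝ → ℝ}, (∀ t, B < t → w t = 0) → ∀ x, 0 < x →
      ∫ r in Ioi 0, κ r * w (x + r) = ∫ r, (Ioc 0 B).indicator κ r * w (x + r) := by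
    intro w hw x hx
    rw [← integral_indicator measurableSet_Ioi]
    congr 1
    funext r
    by_cases h0 : 0 < r
    · by_cases hr : r ≤ B
      · simp [indicator, h0, hr]
      · simp [indicator, h0, hw (x + r) (by linarith [not_le.mp hr])]
    · simp [indicator, h0]
  have key := (hasDerivAt_integral_of_dominated_loc_of_deriv_le (μ := volume) (𝕜 := ℝ)
    (F := fun x r => (Ioc 0 B).indicator κ r * η (x + r))
    (F' := fun x r => (Ioc 0 B).indicator κ r * deriv η (x + r)) (x₀ := s)
    (s := univ) (bound := fun r => |(Ioc 0 B).indicator κ r| * C) univ_mem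
    (Eventually.of_forall fun x => (hκ.trunc B).aestronglyMeasurable.mul
      (hη.continuous.comp (by fun_prop : Continuous fun r => x + r)).aestronglyMeasurable)
    ((hκ.trunc B).mul_bdd (c := C')
      (hη.continuous.comp (by fun_prop : Continuous fun r => s + r)).aestronglyMeasurable
      (Eventually.of_forall fun r => hC' _))
    ((hκ.trunc B).aestronglyMeasurable.mul
      (hd.comp (by fun_prop : Continuous fun r => s + r)).aestronglyMeasurable)
    (Eventually.of_forall fun r x _ => by
      rw [norm_mul]
      exact mul_le_mul_of_nonneg_left (hC _) (abs_nonneg _))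
    ((hκ.trunc B).abs.mul_const C)
    (Eventually.of_forall fun r x _ => by
      have h1 : HasDerivAt η (deriv η (x + r)) (x + r) :=
        (hη.differentiable (by simp) _).hasDerivAt
      exact (h1.comp_add_const x r).const_mul _)).2
  rw [hint (fun t ht => hb' t ((le_max_right _ _).trans_lt ht)) s hs]
  refine key.congr_of_eventuallyEq ?_
  filter_upwards [lt_mem_nhds hs] with x hx
  exact hint (fun t ht => hb t ((le_max_left _ _).trans_lt ht)) x hx

/-- The factor $1$ is kept so that $-\eta$ appears as the pairing of $\eta'$ with the kernel $1$;
both sides of the weak equation can then be tested against $\eta'$. -/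
theorem integral_Ioi_deriv_add {η : ℝ → ℝ} (hη : ContDiff ℝ (⊤ : ℕ∞) η)
    (hηc : HasCompactSupport η) (s : ℝ) : ∫ r in Ioi 0, 1 * deriv η (s + r) = -η s := by
  have h1 : ContDiff ℝ 1 (fun r => η (s + r)) := by
    have : ContDiff ℝ 1 η := hη.of_le (by simp)
    fun_prop
  have h2 : HasCompactSupport (fun r => η (s + r)) :=
    hηc.comp_homeomorph (Homeomorph.addLeft s)
  have := h2.integral_Ioi_deriv_eq h1 0
  simp only [deriv_comp_const_add, add_zero] at this
  simpa using this

/-- The weak equation, in terms of convolutions. -/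
theorem hasCaputoDeriv_iff {κ ψ : ℝ → ℝ} (hκ : IsHalfLineLocallyIntegrable κ) {θ : ℝ}
    (hψ : ContinuousOn ψ (Ici 0)) :
    HasCaputoDeriv κ ψ (fun t => -θ * ψ t) ↔
      ∀ η : ℝ → ℝ, ContDiff ℝ (⊤ : ℕ∞) η → HasCompactSupport η → tsupport η ⊆ Ioi 0 →
        ∫ t in Ioi 0, deriv η t * causalConv (fun s => ψ s - ψ 0) κ t =
          -θ * ∫ t in Ioi 0, deriv η t * causalConv ψ (fun _ => 1) t := by
  have hone : IsHalfLineLocallyIntegrable fun _ => 1 :=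
    continuousOn_const.isHalfLineLocallyIntegrable
  refine forall_congr' fun η => forall_congr' fun hη => forall_congr' fun hηc =>
    forall_congr' fun _ => ?_
  have hd : Continuous (deriv η) := hη.continuous_deriv (by simp)
  have h1 : derivPairing ψ (reflConv κ η) =
      -∫ t in Ioi 0, deriv η t * causalConv (fun s => ψ s - ψ 0) κ t := by
    have hψ0 : ContinuousOn (fun s => ψ s - ψ 0) (Ici 0) := hψ.sub continuousOn_const
    rw [derivPairing, ← hψ0.isHalfLineLocallyIntegrable.integral_mul_integral hκ hd hηc.deriv]
    congr 1
    refine setIntegral_congr_fun measurableSet_Ioi fun s hs => ?_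
    simp only [(hasDerivAt_reflConv hκ hη hηc hs).deriv]
  have h2 : ∫ t in Ioi 0, -θ * ψ t * η t =
      θ * ∫ t in Ioi 0, deriv η t * causalConv ψ (fun _ => 1) t := by
    rw [← hψ.isHalfLineLocallyIntegrable.integral_mul_integral hone hd hηc.deriv,
      ← integral_const_mul]
    refine setIntegral_congr_fun measurableSet_Ioi fun s hs => ?_
    simp only [integral_Ioi_deriv_add hη hηc s]
    ring
  rw [h1, h2, neg_eq_iff_eq_neg, neg_mul]

/-! ### Weak derivatives and the tools for uniqueness -/

theorem exists_primitive_of_integral_eq_zero {w : ℝ → ℝ} (hw : ContDiff ℝ (⊤ : ℕ∞) w)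
    (hwc : HasCompactSupport w) (hws : tsupport w ⊆ Ioi 0) (hw0 : ∫ t, w t = 0) :
    ∃ η : ℝ → ℝ, ContDiff ℝ (⊤ : ℕ∞) η ∧ HasCompactSupport η ∧ tsupport η ⊆ Ioi 0 ∧
      deriv η = w := by
  have hcont := hw.continuous
  obtain ⟨a, b, ha, hab⟩ : ∃ a b : ℝ, 0 < a ∧ ∀ t, t ∉ Icc a b → w t = 0 := by
    rcases (tsupport w).eq_empty_or_nonempty with he | hne
    · refine ⟨1, 0, one_pos, fun t _ => image_eq_zero_of_notMem_tsupport ?_⟩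
      rw [he]; exact notMem_empty t
    · refine ⟨sInf (tsupport w), sSup (tsupport w), hws (hwc.isCompact.sInf_mem hne),
        fun t ht => image_eq_zero_of_notMem_tsupport fun h => ht
          ⟨csInf_le hwc.isCompact.bddBelow h, le_csSup hwc.isCompact.bddAbove h⟩⟩
  have hderiv : ∀ t, HasDerivAt (fun x => ∫ s in (0 : ℝ)..x, w s) (w t) t := fun t =>
    intervalIntegral.integral_hasDerivAt_right (hcont.intervalIntegrable _ _)
      (hcont.stronglyMeasurableAtFilter _ _) hcont.continuousAt
  have hsupp : ∀ t, t ∉ Icc a b → ∫ s in (0 : ℝ)..t, w s = 0 := by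
    intro t ht
    rcases lt_or_ge t a with hta | hta
    · refine intervalIntegral.integral_zero_ae (Eventually.of_forall fun s hs => hab s fun h => ?_)
      rw [uIoc, mem_Ioc] at hs
      have : max 0 t < a := max_lt ha hta
      linarith [h.1]
    · have htb : b < t := not_le.mp fun h => ht ⟨hta, h⟩
      rw [intervalIntegral.integral_of_le (by linarith),
        setIntegral_eq_integral_of_forall_compl_eq_zero, hw0]
      intro s hs
      refine hab s fun h => hs ⟨by linarith [h.1], by linarith [h.2]⟩
  have hts : tsupport (fun x => ∫ s in (0 : ℝ)..x, w s) ⊆ Icc a b := by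
    refine closure_minimal (fun t ht => ?_) isClosed_Icc
    by_contra h
    exact ht (hsupp t h)
  have hdfun : deriv (fun x => ∫ s in (0 : ℝ)..x, w s) = w := funext fun t => (hderiv t).deriv
  refine ⟨_, ?_, HasCompactSupport.of_support_subset_isCompact isCompact_Icc
    (subset_closure.trans hts), hts.trans fun t ht => ha.trans_le ht.1, hdfun⟩
  rw [contDiff_infty_iff_deriv, hdfun]
  exact ⟨fun t => (hderiv t).differentiableAt, hw⟩

/-- The du Bois-Reymond lemma on `(0, ∞)`. -/
theorem exists_ae_eq_const_of_integral_deriv_mul_eq_zero {h : ℝ → ℝ}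
    (hh : IsHalfLineLocallyIntegrable h)
    (hz : ∀ η : ℝ → ℝ, ContDiff ℝ (⊤ : ℕ∞) η → HasCompactSupport η → tsupport η ⊆ Ioi 0 →
      ∫ t in Ioi 0, deriv η t * h t = 0) :
    ∃ c, ∀ᵐ t : ℝ, t ∈ Ioi (0 : ℝ) → h t = c := by
  -- A bump of mass $1$ supported in $[1,3]$. For any test function $g$, $g-(\int g)\,r$ has
  -- integral zero and so is the derivative of a test function; the constant must be $\int r h$.
  let ρ : ContDiffBump (2 : ℝ) := ⟨1 / 2, 1, by norm_num, by norm_num⟩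
  set r := ρ.normed volume with hr
  have hrs : ContDiff ℝ (⊤ : ℕ∞) r := ρ.contDiff_normed
  have hrc : HasCompactSupport r := ρ.hasCompactSupport_normed
  have hrt : tsupport r ⊆ Ioi 0 := by
    rw [hr, ρ.tsupport_normed_eq]
    intro t ht
    have h1 := abs_le.mp (Real.dist_eq t 2 ▸ Metric.mem_closedBall.mp ht)
    have h2 : ρ.rOut = 1 := rfl
    rw [h2] at h1
    have : 0 < t := by linarith [h1.1]
    exact this
  refine ⟨∫ t in Ioi 0, r t * h t, ?_⟩
  set c := ∫ t in Ioi 0, r t * h t with hc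
  have hcl : IsHalfLineLocallyIntegrable fun _ => c :=
    continuousOn_const.isHalfLineLocallyIntegrable
  have key : ∀ᵐ t : ℝ, t ∈ Ioi (0 : ℝ) → h t - c = 0 := by
    refine isOpen_Ioi.ae_eq_zero_of_integral_contDiff_smul_eq_zero
      (hh.locallyIntegrableOn.sub hcl.locallyIntegrableOn) fun g hg hgc hgs => ?_
    have hg0 : ∀ t, t ∉ Ioi (0 : ℝ) → g t = 0 := fun t ht =>
      image_eq_zero_of_notMem_tsupport fun h => ht (hgs h)
    have hgi : Integrable g := hg.continuous.integrable_of_hasCompactSupport hgc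
    have hri : Integrable r := hrs.continuous.integrable_of_hasCompactSupport hrc
    have hgI : ∫ t in Ioi 0, g t = ∫ t, g t :=
      setIntegral_eq_integral_of_forall_compl_eq_zero fun t ht => hg0 t ht
    obtain ⟨η, hη, hηc, hηs, hηd⟩ := exists_primitive_of_integral_eq_zero
      (w := fun t => g t - (∫ x, g x) * r t) (hg.sub (contDiff_const.mul hrs))
      (hgc.sub (hrc.mul_left (f := fun _ => ∫ x, g x)))
      ((tsupport_sub _ _).trans (union_subset hgs
        ((tsupport_mul_subset_right (f := fun _ => ∫ x, g x)).trans hrt)))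
      (by
        rw [integral_sub hgi (hri.const_mul _), integral_const_mul, ρ.integral_normed]
        ring)
    have h1 := hz η hη hηc hηs
    rw [hηd] at h1
    simp_rw [sub_mul, mul_assoc] at h1
    rw [integral_sub (hh.integrableOn_mul hg.continuous hgc)
      ((hh.integrableOn_mul hrs.continuous hrc).const_mul _), integral_const_mul, ← hc] at h1
    rw [← setIntegral_eq_integral_of_forall_compl_eq_zero (s := Ioi 0)
      (fun t ht => by rw [hg0 t ht, zero_smul])]
    simp_rw [smul_eq_mul, mul_sub]
    rw [integral_sub (hh.integrableOn_mul hg.continuous hgc) (hgi.integrableOn.mul_const c),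
      integral_mul_const, hgI, h1]
  filter_upwards [key] with t ht h0
  exact sub_eq_zero.mp (ht h0)

/-- A convolution with a continuous function that is almost everywhere constant is zero. -/
theorem eq_zero_of_ae_causalConv_eq_const {u k : ℝ → ℝ} (hu : Continuous u)
    (hk : IsHalfLineLocallyIntegrable k) {c : ℝ}
    (h : ∀ᵐ t : ℝ, t ∈ Ioi (0 : ℝ) → causalConv u k t = c) : c = 0 := by
  obtain ⟨M, hM⟩ := isCompact_Icc.exists_bound_of_continuousOn
    (hu.continuousOn (s := Icc (0 : ℝ) 1))
  have hM0 : 0 ≤ M := (norm_nonneg _).trans (hM 0 ⟨le_rfl, zero_le_one⟩)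
  have hki := (hk.trunc 1).abs
  have hcont : Continuous fun b => M * ∫ x in (0 : ℝ)..b, |(Ioc 0 1).indicator k x| :=
    continuous_const.mul
      (intervalIntegral.continuous_primitive (fun a b => hki.intervalIntegrable) 0)
  -- The bound $\sup_{[0,1]}|u|\int_0^t|k|$ tends to $0$ with $t$, which contradicts $|c|>0$ on a
  -- set of positive measure.
  have hbound : ∀ t ∈ Ioo (0 : ℝ) 1, |causalConv u k t| ≤
      M * ∫ x in (0 : ℝ)..t, |(Ioc 0 1).indicator k x| := by
    intro t ht
    rw [causalConv_comm, causalConv, intervalIntegral.integral_of_le ht.1.le,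
      integral_Ioc_eq_integral_Ioo, ← integral_const_mul, ← Real.norm_eq_abs]
    refine norm_integral_le_of_norm_le (hki.integrableOn.const_mul M) ?_
    filter_upwards [ae_restrict_mem measurableSet_Ioo] with s hs
    rw [indicator_of_mem (show s ∈ Ioc 0 1 from ⟨hs.1, by linarith [hs.2, ht.2]⟩), norm_mul,
      mul_comm]
    exact mul_le_mul_of_nonneg_right
      (hM _ ⟨by linarith [hs.2], by linarith [hs.1, ht.2]⟩) (norm_nonneg _)
  by_contra hc
  have hev : ∀ᶠ t in nhds (0 : ℝ), M * ∫ x in (0 : ℝ)..t, |(Ioc 0 1).indicator k x| < |c| := by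
    refine (hcont.tendsto 0).eventually (gt_mem_nhds ?_)
    simpa using hc
  obtain ⟨δ, hδ, hδ'⟩ := Metric.eventually_nhds_iff.mp hev
  have hpos : (0 : ℝ≥0∞) < volume (Ioo (0 : ℝ) (min δ 1)) := by
    rw [Real.volume_Ioo, ENNReal.ofReal_pos, sub_zero]
    exact lt_min hδ one_pos
  refine hpos.ne' (measure_mono_null (fun t ht => ?_) (ae_iff.mp h))
  intro hcon
  have ht1 : t < 1 := ht.2.trans_le (min_le_right _ _)
  have ht2 : t < δ := ht.2.trans_le (min_le_left _ _)
  have h1 := hbound t ⟨ht.1, ht1⟩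
  rw [hcon ht.1] at h1
  have h2 := hδ' (y := t) (by rw [Real.dist_eq, sub_zero, abs_of_pos ht.1]; exact ht2)
  linarith

theorem eq_zero_of_ae_causalConv_id_eq_zero {u : ℝ → ℝ} (hu : Continuous u)
    (h : ∀ᵐ t : ℝ, t ∈ Ioi (0 : ℝ) → causalConv u (fun s => s) t = 0) {t : ℝ} (ht : 0 ≤ t) :
    u t = 0 := by
  have hI : ∀ {v : ℝ → ℝ}, Continuous v → ∀ x,
      HasDerivAt (fun x => ∫ s in (0 : ℝ)..x, v s) (v x) x := fun hv x =>
    intervalIntegral.integral_hasDerivAt_right (hv.intervalIntegrable _ _)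
      (hv.stronglyMeasurableAtFilter _ _) hv.continuousAt
  have hsu : Continuous fun s => s * u s := continuous_id.mul hu
  -- $V$ is the convolution of $u$ with $t$; it is differentiable with $V'(x)=\int_0^x u$ and
  -- $V''=u$.
  set V : ℝ → ℝ := fun x => x * (∫ s in (0 : ℝ)..x, u s) - ∫ s in (0 : ℝ)..x, s * u s with hV
  have hVd : ∀ x, HasDerivAt V (∫ s in (0 : ℝ)..x, u s) x := fun x => by
    have := ((hasDerivAt_id x).mul (hI hu x)).sub (hI hsu x)
    refine this.congr_deriv ?_
    simp
  have hVc : Continuous V := continuous_iff_continuousAt.mpr fun x => (hVd x).continuousAt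
  have hVeq : ∀ x, 0 < x → causalConv u (fun s => s) x = V x := by
    intro x hx
    rw [causalConv, ← integral_Ioc_eq_integral_Ioo, ← intervalIntegral.integral_of_le hx.le]
    simp only [hV]
    rw [← intervalIntegral.integral_const_mul, ← intervalIntegral.integral_sub
      ((hu.const_mul x).intervalIntegrable _ _) (hsu.intervalIntegrable _ _)]
    refine intervalIntegral.integral_congr fun s _ => ?_
    ring
  have hV0 : ∀ x ∈ Ioi (0 : ℝ), V x = 0 := by
    have h1 : V =ᵐ[volume.restrict (Ioi 0)] fun _ => 0 := by
      rw [EventuallyEq, ae_restrict_iff' measurableSet_Ioi]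
      filter_upwards [h] with x hx hx0
      rw [← hVeq x hx0, hx hx0]
    exact Measure.eqOn_open_of_ae_eq h1 isOpen_Ioi hVc.continuousOn continuousOn_const
  have hU0 : ∀ x ∈ Ioi (0 : ℝ), ∫ s in (0 : ℝ)..x, u s = 0 := fun x hx => by
    have h1 : V =ᶠ[nhds x] fun _ => 0 := by
      filter_upwards [Ioi_mem_nhds hx] with y hy using hV0 y hy
    exact (hVd x).unique ((hasDerivAt_const x (0 : ℝ)).congr_of_eventuallyEq h1)
  have hu0 : ∀ x ∈ Ioi (0 : ℝ), u x = 0 := fun x hx => by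
    have h1 : (fun x => ∫ s in (0 : ℝ)..x, u s) =ᶠ[nhds x] fun _ => 0 := by
      filter_upwards [Ioi_mem_nhds hx] with y hy using hU0 y hy
    exact (hI hu x).unique ((hasDerivAt_const x (0 : ℝ)).congr_of_eventuallyEq h1)
  have hcl : closure (Ioi (0 : ℝ)) ⊆ {x | u x = 0} :=
    closure_minimal hu0 (isClosed_eq hu continuous_const)
  rw [closure_Ioi] at hcl
  exact hcl ht

/-! ### The relaxation function: equation and uniqueness -/

/-- A nonincreasing continuous function starting at `1`, whose Laplace transform is
`Φ(lam) / (lam (θ + Φ(lam)))`. -/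
structure IsRelaxationFunction (Φ : ℝ → ℝ) (θ : ℝ) (φ : ℝ → ℝ) : Prop where
  continuous : Continuous φ
  antitone : Antitone φ
  nonneg : ∀ t, 0 ≤ φ t
  initial : φ 0 = 1
  laplace : ∀ lam, 0 < lam →
    ∫ t in Ioi 0, Real.exp (-lam * t) * φ t = Φ lam / (lam * (θ + Φ lam))

theorem IsSubordinator.isRelaxationFunction {Ω : Type*} [MeasurableSpace Ω] {P : Measure Ω}
    [IsProbabilityMeasure P] {Lvy : Measure ℝ} (hLvy : IsInfiniteLevyMeasure Lvy)
    {H : ℝ≥0 → Ω → ℝ} (hH : IsSubordinator P H (bernsteinSymbol Lvy)) {θ : ℝ} (hθ : 0 < θ) :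
    IsRelaxationFunction (bernsteinSymbol Lvy) θ (inverseLaplace P H θ) := by
  obtain ⟨K, hK, hKH⟩ := hH.exists_modification hLvy
  rw [inverseLaplace_congr hKH]
  have hlap : ∀ (t : ℝ≥0) (lam : ℝ), 0 < lam →
      ∫ ω, Real.exp (-lam * K t ω) ∂P = Real.exp (-(t : ℝ) * bernsteinSymbol Lvy lam) := by
    intro t lam hl
    rw [← hH.laplace t lam hl]
    refine integral_congr_ae ?_
    filter_upwards [hKH] with ω hω
    simp only [hω]
  exact ⟨hK.continuous_inverseLaplace hθ.le, hK.antitone_inverseLaplace hθ.le,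
    IsStrictlyIncreasingProcess.inverseLaplace_nonneg K θ, hK.inverseLaplace_zero θ,
    fun lam hl => hK.integral_exp_mul_inverseLaplace hlap hθ hl (hLvy.symbol_pos hl)⟩

theorem integrableOn_exp_mul_one {lam : ℝ} (hl : 0 < lam) :
    IntegrableOn (fun t => Real.exp (-lam * t) * (1 : ℝ)) (Ioi 0) := by
  simpa only [mul_one] using integrableOn_exp_mul_Ioi (neg_neg_of_pos hl) 0

theorem integral_exp_mul_one {lam : ℝ} (hl : 0 < lam) :
    ∫ t in Ioi 0, Real.exp (-lam * t) * (1 : ℝ) = 1 / lam := by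
  simp_rw [mul_one]
  rw [integral_exp_mul_Ioi (neg_neg_of_pos hl)]
  simp

namespace IsRelaxationFunction

variable {Φ φ κ : ℝ → ℝ} {θ : ℝ}

theorem le_one (h : IsRelaxationFunction Φ θ φ) {t : ℝ} (ht : 0 ≤ t) : φ t ≤ 1 :=
  h.initial ▸ h.antitone ht

theorem integrableOn_exp_mul (h : IsRelaxationFunction Φ θ φ) {lam : ℝ} (hl : 0 < lam) :
    IntegrableOn (fun t => Real.exp (-lam * t) * φ t) (Ioi 0) := by
  refine (integrableOn_exp_mul_Ioi (neg_neg_of_pos hl) 0).mul_bdd (c := 1)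
    h.continuous.aestronglyMeasurable ?_
  filter_upwards [ae_restrict_mem measurableSet_Ioi] with t ht
  rw [Real.norm_of_nonneg (h.nonneg t)]
  exact h.le_one (le_of_lt ht)

theorem integrableOn_exp_mul_one_sub (h : IsRelaxationFunction Φ θ φ) {lam : ℝ} (hl : 0 < lam) :
    IntegrableOn (fun t => Real.exp (-lam * t) * (1 - φ t)) (Ioi 0) := by
  simp_rw [mul_sub]
  exact (integrableOn_exp_mul_one hl).sub (h.integrableOn_exp_mul hl)

theorem laplace_one_sub (h : IsRelaxationFunction Φ θ φ) (hθ : 0 < θ)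
    (hΦ : ∀ lam, 0 < lam → 0 < Φ lam) {lam : ℝ} (hl : 0 < lam) :
    ∫ t in Ioi 0, Real.exp (-lam * t) * (1 - φ t) = θ / (lam * (θ + Φ lam)) := by
  have := hΦ lam hl
  simp_rw [mul_sub]
  rw [integral_sub (integrableOn_exp_mul_one hl) (h.integrableOn_exp_mul hl),
    integral_exp_mul_one hl, h.laplace lam hl]
  field_simp
  ring

/-- The integrated form of the equation: both sides have transform
$\theta\Phi/(\lambda^2(\theta+\Phi))$. -/
theorem causalConv_one_sub_kernel (h : IsRelaxationFunction Φ θ φ) (hθ : 0 < θ)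
    (hΦ : ∀ lam, 0 < lam → 0 < Φ lam) (hκ : IsKernelOf Φ κ) :
    ∀ᵐ t : ℝ, t ∈ Ioi (0 : ℝ) →
      causalConv (fun s => 1 - φ s) κ t = θ * causalConv φ (fun _ => 1) t := by
  refine ae_eq_of_laplace_eq
    (fun lam hl => integrableOn_exp_mul_causalConv (h.integrableOn_exp_mul_one_sub hl) (hκ lam hl).1)
    (fun lam hl => ?_) (fun lam hl => ?_)
  · simp_rw [mul_left_comm _ θ]
    exact (integrableOn_exp_mul_causalConv (h.integrableOn_exp_mul hl)
      (integrableOn_exp_mul_one hl)).const_mul θ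
  · have := hΦ lam hl
    simp_rw [mul_left_comm _ θ]
    rw [integral_const_mul, integral_exp_mul_causalConv (h.integrableOn_exp_mul_one_sub hl)
      (hκ lam hl).1, integral_exp_mul_causalConv (h.integrableOn_exp_mul hl)
      (integrableOn_exp_mul_one hl), h.laplace_one_sub hθ hΦ hl, (hκ lam hl).2,
      integral_exp_mul_one hl, h.laplace lam hl]
    field_simp

/-- The factor $\theta+\Phi$ cancels:
$\frac{\Phi+\theta}{\lambda}\cdot\frac{\theta}{\lambda(\theta+\Phi)}=\theta/\lambda^2$. Thus
$1-\varphi$ inverts $\kappa+\theta$ up to a double integration. -/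
theorem causalConv_one_sub_kernel_add (h : IsRelaxationFunction Φ θ φ) (hθ : 0 < θ)
    (hΦ : ∀ lam, 0 < lam → 0 < Φ lam) (hκ : IsKernelOf Φ κ) :
    ∀ᵐ t : ℝ, t ∈ Ioi (0 : ℝ) →
      causalConv (fun s => κ s + θ) (fun s => 1 - φ s) t = θ * t := by
  have hcc : ∀ t : ℝ, t ∈ Ioi (0 : ℝ) → causalConv (fun _ => 1) (fun _ => 1) t = t := by
    intro t ht
    simp [causalConv, le_of_lt (mem_Ioi.mp ht)]
  have hk : ∀ lam, 0 < lam → IntegrableOn (fun t => Real.exp (-lam * t) * (κ t + θ)) (Ioi 0) ∧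
      ∫ t in Ioi 0, Real.exp (-lam * t) * (κ t + θ) = (Φ lam + θ) / lam := by
    intro lam hl
    have h1 : IntegrableOn (fun t => Real.exp (-lam * t) * θ) (Ioi 0) := by
      refine IntegrableOn.congr_fun ((integrableOn_exp_mul_one hl).mul_const θ) (fun t _ => ?_)
        measurableSet_Ioi
      simp only [mul_one]
    have h2 : ∫ t in Ioi 0, Real.exp (-lam * t) * θ = 1 / lam * θ := by
      rw [← integral_exp_mul_one hl, ← integral_mul_const]
      simp_rw [mul_one]
    simp_rw [mul_add]
    refine ⟨(hκ lam hl).1.add h1, ?_⟩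
    rw [integral_add (hκ lam hl).1 h1, h2, (hκ lam hl).2]
    ring
  have key : ∀ᵐ t : ℝ, t ∈ Ioi (0 : ℝ) → causalConv (fun s => κ s + θ) (fun s => 1 - φ s) t =
      θ * causalConv (fun _ => 1) (fun _ => 1) t := by
    refine ae_eq_of_laplace_eq
      (fun lam hl => integrableOn_exp_mul_causalConv (hk lam hl).1
        (h.integrableOn_exp_mul_one_sub hl)) (fun lam hl => ?_) (fun lam hl => ?_)
    · simp_rw [mul_left_comm _ θ]
      exact (integrableOn_exp_mul_causalConv (integrableOn_exp_mul_one hl)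
        (integrableOn_exp_mul_one hl)).const_mul θ
    · have := hΦ lam hl
      simp_rw [mul_left_comm _ θ]
      rw [integral_const_mul, integral_exp_mul_causalConv (hk lam hl).1
        (h.integrableOn_exp_mul_one_sub hl), integral_exp_mul_causalConv
        (integrableOn_exp_mul_one hl) (integrableOn_exp_mul_one hl), (hk lam hl).2,
        h.laplace_one_sub hθ hΦ hl, integral_exp_mul_one hl]
      field_simp
      ring
  filter_upwards [key] with t ht h0
  rw [ht h0, hcc t h0]

theorem isRelaxationSolution (h : IsRelaxationFunction Φ θ φ) (hθ : 0 < θ)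
    (hΦ : ∀ lam, 0 < lam → 0 < Φ lam) (hκ : IsKernelOf Φ κ) : IsRelaxationSolution κ θ φ := by
  refine ⟨h.continuous.continuousOn, h.initial, ?_⟩
  rw [hasCaputoDeriv_iff (isHalfLineLocallyIntegrable_of_exp_mul (hκ 1 one_pos).1)
    h.continuous.continuousOn]
  intro η _ _ _
  rw [← integral_const_mul]
  refine setIntegral_congr_ae measurableSet_Ioi ?_
  filter_upwards [h.causalConv_one_sub_kernel hθ hΦ hκ] with t ht h0
  have h1 : causalConv (fun s => φ s - φ 0) κ t = -causalConv (fun s => 1 - φ s) κ t := by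
    rw [causalConv, causalConv, ← integral_neg]
    congr 1
    funext s
    rw [h.initial]
    ring
  rw [h1, ht h0]
  ring

theorem eq_of_isRelaxationSolution (h : IsRelaxationFunction Φ θ φ) (hθ : 0 < θ)
    (hΦ : ∀ lam, 0 < lam → 0 < Φ lam) (hκ : IsKernelOf Φ κ) {ψ : ℝ → ℝ}
    (hψ : IsRelaxationSolution κ θ ψ) {t : ℝ} (ht : 0 ≤ t) : ψ t = φ t := by
  have hκl := isHalfLineLocallyIntegrable_of_exp_mul (hκ 1 one_pos).1
  have hconst : ∀ c : ℝ, IsHalfLineLocallyIntegrable fun _ => c := fun c =>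
    continuousOn_const.isHalfLineLocallyIntegrable
  have hφs := h.isRelaxationSolution hθ hΦ hκ
  have hψl := hψ.continuousOn.isHalfLineLocallyIntegrable
  have hφl := hφs.continuousOn.isHalfLineLocallyIntegrable
  have hψ0 : IsHalfLineLocallyIntegrable fun s => ψ s - ψ 0 := fun b => (hψl b).sub (hconst _ b)
  have hφ0 : IsHalfLineLocallyIntegrable fun s => φ s - φ 0 := fun b => (hφl b).sub (hconst _ b)
  have hkl : IsHalfLineLocallyIntegrable fun s => κ s + θ := hκl.add (hconst θ)
  -- Composition with $\max(s,0)$ makes $u$ continuous on the whole line; convolutions use only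
  -- $s>0$.
  set u : ℝ → ℝ := fun s => ψ (max s 0) - φ (max s 0) with hu
  have huc : Continuous u :=
    (hψ.continuousOn.comp_continuous (by fun_prop) fun s => le_max_right s 0).sub
      (h.continuous.comp (by fun_prop))
  have hul : IsHalfLineLocallyIntegrable u := huc.continuousOn.isHalfLineLocallyIntegrable
  -- The equal initial values cancel, so $u$ itself, without a constant, is convolved with $\kappa$.
  have hsplit : ∀ᵐ t : ℝ, causalConv u (fun s => κ s + θ) t =
      (causalConv (fun s => ψ s - ψ 0) κ t - causalConv (fun s => φ s - φ 0) κ t) +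
        θ * (causalConv ψ (fun _ => 1) t - causalConv φ (fun _ => 1) t) := by
    filter_upwards [hψ0.ae_integrableOn_mul hκl, hφ0.ae_integrableOn_mul hκl,
      hψl.ae_integrableOn_mul (hconst 1), hφl.ae_integrableOn_mul (hconst 1)] with t h1 h2 h3 h4
    have h12 : IntegrableOn (fun s => (ψ s - ψ 0) * κ (t - s) - (φ s - φ 0) * κ (t - s))
      (Ioo 0 t) := h1.sub h2
    have h34 : IntegrableOn (fun s => θ * (ψ s * 1 - φ s * 1)) (Ioo 0 t) :=
      (h3.sub h4).const_mul θ
    simp only [causalConv]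
    rw [← integral_sub h1 h2, ← integral_sub h3 h4, ← integral_const_mul, ← integral_add h12 h34]
    refine setIntegral_congr_fun measurableSet_Ioo fun s hs => ?_
    simp only [hu, max_eq_left hs.1.le, hψ.initial, h.initial]
    ring
  have hzero : ∀ᵐ t : ℝ, t ∈ Ioi (0 : ℝ) → causalConv u (fun s => κ s + θ) t = 0 := by
    suffices hweak : ∀ η : ℝ → ℝ, ContDiff ℝ (⊤ : ℕ∞) η → HasCompactSupport η →
        tsupport η ⊆ Ioi 0 →
        ∫ t in Ioi 0, deriv η t * causalConv u (fun s => κ s + θ) t = 0 by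
      obtain ⟨c, hc⟩ := exists_ae_eq_const_of_integral_deriv_mul_eq_zero (hul.conv hkl) hweak
      rwa [eq_zero_of_ae_causalConv_eq_const huc hkl hc] at hc
    intro η hη hηc hηs
    have hd : Continuous (deriv η) := hη.continuous_deriv (by simp)
    have e1 := (hasCaputoDeriv_iff hκl hψ.continuousOn).mp hψ.equation η hη hηc hηs
    have e2 := (hasCaputoDeriv_iff hκl hφs.continuousOn).mp hφs.equation η hη hηc hηs
    have i1 := (hψ0.conv hκl).integrableOn_mul hd hηc.deriv
    have i2 := (hφ0.conv hκl).integrableOn_mul hd hηc.deriv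
    have i3 := (hψl.conv (hconst 1)).integrableOn_mul hd hηc.deriv
    have i4 := (hφl.conv (hconst 1)).integrableOn_mul hd hηc.deriv
    calc ∫ t in Ioi 0, deriv η t * causalConv u (fun s => κ s + θ) t
        = ∫ t in Ioi 0, ((deriv η t * causalConv (fun s => ψ s - ψ 0) κ t -
            deriv η t * causalConv (fun s => φ s - φ 0) κ t) +
            θ * (deriv η t * causalConv ψ (fun _ => 1) t -
              deriv η t * causalConv φ (fun _ => 1) t)) := by
          refine integral_congr_ae (ae_restrict_of_ae ?_)
          filter_upwards [hsplit] with t ht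
          rw [ht]
          ring
      _ = 0 := by
          have i12 : IntegrableOn (fun t => deriv η t * causalConv (fun s => ψ s - ψ 0) κ t -
            deriv η t * causalConv (fun s => φ s - φ 0) κ t) (Ioi 0) := i1.sub i2
          have i34 : IntegrableOn (fun t => θ * (deriv η t * causalConv ψ (fun _ => 1) t -
            deriv η t * causalConv φ (fun _ => 1) t)) (Ioi 0) := (i3.sub i4).const_mul θ
          rw [integral_add i12 i34, integral_sub i1 i2, integral_const_mul, integral_sub i3 i4, e1, e2]
          ring
  have hml : IsHalfLineLocallyIntegrable fun s => 1 - φ s :=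
    (continuous_const.sub h.continuous).continuousOn.isHalfLineLocallyIntegrable
  have hid : ∀ᵐ t : ℝ, t ∈ Ioi (0 : ℝ) → causalConv u (fun s => s) t = 0 := by
    -- Associativity evaluates $u*(\kappa+\theta)*(1-\varphi)$ both as $0*(1-\varphi)$ and as
    -- $u*\theta t$.
    filter_upwards [hul.causalConv_assoc hkl hml] with t ht _
    rw [causalConv_congr_left hzero,
      causalConv_congr_right (h.causalConv_one_sub_kernel_add hθ hΦ hκ)] at ht
    have h1 : causalConv u (fun s => θ * s) t = θ * causalConv u (fun s => s) t := by
      rw [causalConv, causalConv, ← integral_const_mul]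
      congr 1
      funext s
      ring
    have h2 : causalConv (fun _ => 0) (fun s => 1 - φ s) t = 0 := by simp [causalConv]
    rw [h1, h2] at ht
    exact (mul_eq_zero.mp ht.symm).resolve_left hθ.ne'
  have := eq_zero_of_ae_causalConv_id_eq_zero huc hid ht
  simp only [hu, max_eq_left ht] at this
  exact sub_eq_zero.mp this

/-- The measure `-dφ` on `(0, ∞)`. -/
theorem exists_negDerivMeasure (h : IsRelaxationFunction Φ θ φ) :
    ∃ μ : Measure ℝ, IsFiniteMeasure μ ∧ IsNegDerivMeasure φ μ := by
  have hmono : Monotone fun t => 1 - φ (max t 0) := fun s t hst =>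
    sub_le_sub_left (h.antitone (max_le_max_right 0 hst)) 1
  have hcont : Continuous fun t => 1 - φ (max t 0) :=
    continuous_const.sub (h.continuous.comp (by fun_prop))
  -- Freezing the function on $t<0$ places no mass there and keeps it bounded, so the measure is
  -- finite.
  let F : StieltjesFunction ℝ := ⟨fun t => 1 - φ (max t 0), hmono,
    fun t => hcont.continuousWithinAt⟩
  have hF : ∀ t, F t = 1 - φ (max t 0) := fun t => rfl
  refine ⟨F.measure, F.isFiniteMeasure_of_forall_abs_le (C := 1) fun t => ?_,
    h.antitone.antitoneOn _, fun t ht => ?_⟩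
  · rw [hF, abs_le]
    have h1 := h.nonneg (max t 0)
    have h2 := h.le_one (le_max_right t 0)
    constructor <;> linarith
  · rw [F.measure_Ioc, hF, hF, max_self, max_eq_left ht]
    congr 1
    ring

end IsRelaxationFunction

/-! ### Convolution of a function with a finite measure -/

section MeasureConvolution

variable {μ : Measure ℝ} [IsFiniteMeasure μ] {g : ℝ → ℝ} {lam : ℝ}

theorem integrable_exp_indicator (μ : Measure ℝ) [IsFiniteMeasure μ] (hl : 0 ≤ lam) :
    Integrable ((Ioi 0).indicator fun s => Real.exp (-lam * s)) μ := by
  refine Integrable.of_bound ((Measurable.indicator (by fun_prop)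
    measurableSet_Ioi).aestronglyMeasurable) 1 (Eventually.of_forall fun s => ?_)
  by_cases hs : 0 < s
  · rw [indicator_of_mem (show s ∈ Ioi 0 from hs), Real.norm_of_nonneg (Real.exp_pos _).le,
      Real.exp_le_one_iff]
    nlinarith
  · rw [indicator_of_notMem (show s ∉ Ioi 0 from hs), norm_zero]
    exact zero_le_one

theorem exp_indicator_mul_exp_indicator (g : ℝ → ℝ) (lam t s : ℝ) :
    (Ioi 0).indicator (fun s => Real.exp (-lam * s)) s *
      (Ioi 0).indicator (fun r => Real.exp (-lam * r) * g r) (t - s) =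
      (Ioo 0 t).indicator (fun s => Real.exp (-lam * t) * g (t - s)) s := by
  have : Real.exp (-lam * t) = Real.exp (-lam * s) * Real.exp (-lam * (t - s)) := by
    rw [← Real.exp_add]; ring_nf
  rw [this]
  by_cases hs : 0 < s <;> by_cases hts : s < t <;> simp [indicator, hs, hts, mul_assoc]

/-- A convolution with respect to $\mu$ in place of Lebesgue measure: the weight $e^{-\lambda s}$ is
$\mu$-integrable and $e^{-\lambda r}g(r)$ is Lebesgue integrable, so Fubini gives absolute
convergence for almost every $t$. -/
theorem ae_integrableOn_comp_sub (hl : 0 ≤ lam)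
    (hg : IntegrableOn (fun t => Real.exp (-lam * t) * g t) (Ioi 0)) :
    ∀ᵐ t : ℝ, IntegrableOn (fun s => g (t - s)) (Ioo 0 t) μ := by
  rw [← integrable_indicator_iff measurableSet_Ioi] at hg
  filter_upwards [(integrable_exp_indicator μ hl).ae_convolution_exists
    (ContinuousLinearMap.mul ℝ ℝ) hg] with t ht
  rw [ConvolutionExistsAt] at ht
  simp only [ContinuousLinearMap.mul_apply', exp_indicator_mul_exp_indicator] at ht
  have h1 := ((integrable_indicator_iff measurableSet_Ioo).mp ht).const_mul (Real.exp (lam * t))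
  refine IntegrableOn.congr_fun h1 (fun s _ => ?_) measurableSet_Ioo
  rw [← mul_assoc, ← Real.exp_add]
  simp

omit [IsFiniteMeasure μ] in
theorem convolution_exp_indicator (g : ℝ → ℝ) (lam t : ℝ) :
    ((Ioi 0).indicator (fun s => Real.exp (-lam * s)) ⋆[ContinuousLinearMap.mul ℝ ℝ, μ]
      (Ioi 0).indicator (fun r => Real.exp (-lam * r) * g r)) t =
      (Ioi 0).indicator (fun t => Real.exp (-lam * t) * ∫ s in Ioo 0 t, g (t - s) ∂μ) t := by
  rw [convolution]
  simp only [ContinuousLinearMap.mul_apply', exp_indicator_mul_exp_indicator]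
  rw [integral_indicator measurableSet_Ioo, integral_const_mul]
  by_cases ht : 0 < t
  · rw [indicator_of_mem (show t ∈ Ioi 0 from ht)]
  · rw [indicator_of_notMem (show t ∉ Ioi 0 from ht), Ioo_eq_empty ht]
    simp

theorem integrableOn_exp_mul_integral_comp_sub (hl : 0 ≤ lam)
    (hg : IntegrableOn (fun t => Real.exp (-lam * t) * g t) (Ioi 0)) :
    IntegrableOn (fun t => Real.exp (-lam * t) * ∫ s in Ioo 0 t, g (t - s) ∂μ) (Ioi 0) := by
  rw [← integrable_indicator_iff measurableSet_Ioi] at hg ⊢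
  have := ((integrable_exp_indicator μ hl).convolution_integrand
    (ContinuousLinearMap.mul ℝ ℝ) hg).integral_prod_left
  exact this.congr (Eventually.of_forall (convolution_exp_indicator g lam))

theorem integral_exp_mul_integral_comp_sub (hl : 0 ≤ lam)
    (hg : IntegrableOn (fun t => Real.exp (-lam * t) * g t) (Ioi 0)) :
    ∫ t in Ioi 0, Real.exp (-lam * t) * ∫ s in Ioo 0 t, g (t - s) ∂μ =
      (∫ s in Ioi 0, Real.exp (-lam * s) ∂μ) * ∫ t in Ioi 0, Real.exp (-lam * t) * g t := by
  rw [← integrable_indicator_iff measurableSet_Ioi] at hg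
  have := integral_convolution (ContinuousLinearMap.mul ℝ ℝ) (integrable_exp_indicator μ hl) hg
  simp only [convolution_exp_indicator] at this
  rw [integral_indicator measurableSet_Ioi, ContinuousLinearMap.mul_apply',
    integral_indicator measurableSet_Ioi, integral_indicator measurableSet_Ioi] at this
  exact this

end MeasureConvolution

/-! ### The equation in integral form -/

namespace IsRelaxationFunction

variable {Φ φ κ : ℝ → ℝ} {θ : ℝ}

/-- Continuity of $\varphi$ excludes an atom at $t$, so the open interval has the mass of the
half-open one. -/
theorem measure_Ioo (h : IsRelaxationFunction Φ θ φ) {μ : Measure ℝ} [IsFiniteMeasure μ]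
    (hμ : IsNegDerivMeasure φ μ) {t : ℝ} (ht : 0 < t) : μ.real (Ioo 0 t) = 1 - φ t := by
  have h1 : ∀ s, 0 ≤ s → μ.real (Ioc 0 s) = 1 - φ s := fun s hs => by
    rw [measureReal_def, hμ.2 s hs, h.initial,
      ENNReal.toReal_ofReal (sub_nonneg.mpr (h.le_one hs))]
  refine le_antisymm ((measureReal_mono Ioo_subset_Ioc_self).trans_eq (h1 t ht.le)) ?_
  have hlim : Tendsto (fun s => 1 - φ s) (nhdsWithin t (Iio t)) (nhds (1 - φ t)) :=
    ((continuous_const.sub h.continuous).tendsto t).mono_left nhdsWithin_le_nhds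
  refine le_of_tendsto hlim ?_
  filter_upwards [Ioo_mem_nhdsLT ht] with s hs
  rw [← h1 s hs.1.le]
  exact measureReal_mono fun x hx => ⟨hx.1, hx.2.trans_lt hs.2⟩

/-- Integration by parts in disguise: with $g=1$ the convolution formula reads
$\hat\mu(\lambda)/\lambda=\widehat{1-\varphi}(\lambda)$. -/
theorem laplace_measure (h : IsRelaxationFunction Φ θ φ) (hθ : 0 < θ)
    (hΦ : ∀ lam, 0 < lam → 0 < Φ lam) {μ : Measure ℝ} [IsFiniteMeasure μ]
    (hμ : IsNegDerivMeasure φ μ) {lam : ℝ} (hl : 0 < lam) :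
    ∫ s in Ioi 0, Real.exp (-lam * s) ∂μ = θ / (θ + Φ lam) := by
  have h1 := integral_exp_mul_integral_comp_sub (μ := μ) (g := fun _ => 1) hl.le
    (integrableOn_exp_mul_one hl)
  have h2 : ∫ t in Ioi 0, Real.exp (-lam * t) * ∫ s in Ioo 0 t, (1 : ℝ) ∂μ =
      ∫ t in Ioi 0, Real.exp (-lam * t) * (1 - φ t) := by
    refine setIntegral_congr_fun measurableSet_Ioi fun t ht => ?_
    simp only [setIntegral_const, smul_eq_mul, mul_one, h.measure_Ioo hμ ht]
  rw [h2, h.laplace_one_sub hθ hΦ hl, integral_exp_mul_one hl] at h1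
  have := hΦ lam hl
  field_simp at h1 ⊢
  linarith

/-- The transforms agree:
$\frac{\theta}{\theta+\Phi}\cdot\frac{\Phi}{\lambda}=\theta\hat\varphi(\lambda)$. -/
theorem ae_integral_kernel (h : IsRelaxationFunction Φ θ φ) (hθ : 0 < θ)
    (hΦ : ∀ lam, 0 < lam → 0 < Φ lam) (hκ : IsKernelOf Φ κ) {μ : Measure ℝ} [IsFiniteMeasure μ]
    (hμ : IsNegDerivMeasure φ μ) :
    ∀ᵐ t : ℝ, t ∈ Ioi (0 : ℝ) → ∫ s in Ioo 0 t, κ (t - s) ∂μ = θ * φ t := by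
  refine ae_eq_of_laplace_eq
    (fun lam hl => integrableOn_exp_mul_integral_comp_sub hl.le (hκ lam hl).1)
    (fun lam hl => ?_) (fun lam hl => ?_)
  · simp_rw [mul_left_comm _ θ]
    exact (h.integrableOn_exp_mul hl).const_mul θ
  · have := hΦ lam hl
    simp_rw [mul_left_comm _ θ]
    rw [integral_const_mul, integral_exp_mul_integral_comp_sub hl.le (hκ lam hl).1,
      h.laplace_measure hθ hΦ hμ hl, (hκ lam hl).2, h.laplace lam hl]
    field_simp

end IsRelaxationFunction

theorem theorem3 {Ω : Type*} [MeasurableSpace Ω] (P : Measure Ω) [IsProbabilityMeasure P]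
    (Lvy : Measure ℝ) (hLvy : IsInfiniteLevyMeasure Lvy)
    (H : ℝ≥0 → Ω → ℝ) (hH : IsSubordinator P H (bernsteinSymbol Lvy))
    (κ : ℝ → ℝ) (hκ : IsKernelOf (bernsteinSymbol Lvy) κ)
    (θ : ℝ) (hθ : 0 < θ) :
    IsRelaxationSolution κ θ (inverseLaplace P H θ) ∧
    (∀ ψ : ℝ → ℝ, IsRelaxationSolution κ θ ψ →
      ∀ t, 0 ≤ t → ψ t = inverseLaplace P H θ t) ∧
    (∃ μ : Measure ℝ, IsNegDerivMeasure (inverseLaplace P H θ) μ ∧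
      ∀ᵐ t ∂(volume.restrict (Ioi (0 : ℝ))),
        IntegrableOn (fun s => κ (t - s)) (Ioo 0 t) μ ∧
        -∫ s in Ioo 0 t, κ (t - s) ∂μ = -θ * inverseLaplace P H θ t) := by
  have h := hH.isRelaxationFunction hLvy hθ
  have hΦ : ∀ lam, 0 < lam → 0 < bernsteinSymbol Lvy lam := fun _ => hLvy.symbol_pos
  refine ⟨h.isRelaxationSolution hθ hΦ hκ,
    fun ψ hψ t ht => h.eq_of_isRelaxationSolution hθ hΦ hκ hψ ht, ?_⟩
  obtain ⟨μ, hfin, hμ⟩ := h.exists_negDerivMeasure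
  refine ⟨μ, hμ, ?_⟩
  rw [ae_restrict_iff' measurableSet_Ioi]
  filter_upwards [ae_integrableOn_comp_sub (μ := μ) zero_le_one (hκ 1 one_pos).1,
    h.ae_integral_kernel hθ hΦ hκ hμ] with t h1 h2 ht
  exact ⟨h1, by rw [h2 ht, neg_mul]⟩
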